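/- Let $p$ be an odd prime, let $q$ be a power of $p$, and let $N,M$ be positive integers with $NM=q^3/p-1$. Let $H=\mathbb F_{q^2}(x,y)$, $y^q+y=x^{q+1}$, be the Hermitian function field, of genus $g=(q^2-q)/2$, and let $P_\infty$ be the unique pole of $x$. Let $\theta\in\mathbb F_{q^2}$ be a nonzero element with $\theta^q+\theta=0$, and let $\phi$ be the automorphism of $H/\mathbb F_{q^2}$ with $\phi(x)=x$ and $\phi(y)=y+\theta$; it has order $p$, and the group it generates acts on the rational places $\neq P_\infty$ of $H$ with $q^3/p$ orbits. Choose one place from each orbit and label the chosen places $P$ and $Q_{i,l}$ ($1\le i\le N$, $1\le l\le M$) in any way. Let $z\in H$ be a function with pole divisor $(z)_\infty=kP_\infty+P$ for some integer $0\le k\le 2g-1$. Let $\mathcal S=\{\mathbf s_1,\dots,\mathbf s_N\}$, where $\mathbf s_i$ is the sequence of length $Mp$ over $\mathbb F_{q^2}$ $$\mathbf s_i=\bigl(z(Q_{i,1}),z(\phi(Q_{i,1})),\dots,z(\phi^{p-1}(Q_{i,1})),\dots,z(Q_{i,M}),\dots,z(\phi^{p-1}(Q_{i,M}))\bigr),$$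 and let $\mathcal S_n$ consist of the first $n$ terms of each $\mathbf s_i$, for $n\le Mp$. For $r\ge 1$, the $r$-th order joint nonlinear complexity $N_r(\mathcal S_n)$ is $0$ if all terms of $\mathcal S_n$ are zero; otherwise it is the least $u\geq 1$ for which there is a polynomial $f\in\mathbb F_{q^2}[x_1,\dots,x_u]$, of degree at most $r$ in each variable, with $s_i(j+u)=f(s_i(j),\dots,s_i(j+u-1))$ for all $1\le i\le N$ and $0\le j\le n-u-1$ (and $n$ if there is no such $u<n$). Then for every $n\le Mp$ and every integer $r$ with $1\le r\le q^2-1$: (a) if $nN>q^2-q$, then $\mathcal S_n$ is not identically zero; (b) if $\mathcal S_n$ is not identically zero, then $$N_r(\mathcal S_n)\ \ge\ \begin{cases}\dfrac{nN-1}{N+(q^2-q)r}, & \text{if } 1<n\le p,\\[2ex] \dfrac{pN\lfloor n/p\rfloor-1}{N\lfloor n/p\rfloor+(q^2-q)r}, & \text{if } p\le n\le Mp.\end{cases}$$ -/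

import Mathlib

open Polynomial

section Sequences

/-- `f ∈ K[x_1, …, x_u]` generates all the sequences `s_i = (s_i(0), …, s_i(n-1))`, `i ∈ ι`:
`s_i(j+u) = f(s_i(j), …, s_i(j+u-1))` for all `i` and all `0 ≤ j ≤ n-u-1`. -/
def GeneratesMultisequence {K ι : Type*} [Field K] {n u : ℕ}
    (f : MvPolynomial (Fin u) K) (S : ι → Fin n → K) : Prop :=
  ∀ (i : ι) (j : ℕ) (h : j + u < n),
    S i ⟨j + u, h⟩ = MvPolynomial.eval (fun t : Fin u => S i ⟨j + t, by omega⟩) f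

/-- There is a polynomial in `u` variables, of degree at most `r` in each variable, that
generates all the sequences of `S`. -/
def IsGeneratedWithOrder {K ι : Type*} [Field K] {n : ℕ} (r : ℕ) (S : ι → Fin n → K)
    (u : ℕ) : Prop :=
  ∃ f : MvPolynomial (Fin u) K,
    (∀ t : Fin u, MvPolynomial.degreeOf t f ≤ r) ∧ GeneratesMultisequence f S

open Classical in
/-- The `r`-th order joint nonlinear complexity `N_r(S)` of a multisequence `S` with terms
`S i j`, `0 ≤ j < n`. It is `0` if all the sequences are zero; otherwise it is the least `u ≥ 1`
with `u < n` such that `S` is generated by a polynomial in `u` variables of degree at most `r`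
in each variable, and `n` if there is no such `u`. -/
noncomputable def jointNonlinearComplexity {K ι : Type*} [Field K] {n : ℕ} (r : ℕ)
    (S : ι → Fin n → K) : ℕ :=
  if ∀ i j, S i j = 0 then 0
  else if h : ∃ u : ℕ, 1 ≤ u ∧ u < n ∧ IsGeneratedWithOrder r S u then Nat.find h
  else n

/-- The multisequence `S_n` that consists of the first `n` terms of each sequence of `S`. -/
def truncate {K ι : Type*} {L n : ℕ} (S : ι → Fin L → K) (h : n ≤ L) : ι → Fin n → K :=
  fun i j => S i (Fin.castLE h j)

end Sequences

section Places

/-- A place of a function field `F` over `K`, given by its valuation ring: a discrete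
valuation ring of `F` that contains the constants. -/
@[ext]
structure Place (K F : Type*) [Field K] [Field F] [Algebra K F] where
  /-- the valuation ring `O_P` -/
  ring : ValuationSubring F
  const_mem : ∀ a : K, algebraMap K F a ∈ ring
  isDVR : IsDiscreteValuationRing ring

namespace Place

variable {K F : Type*} [Field K] [Field F] [Algebra K F]

instance (P : Place K F) : IsDiscreteValuationRing P.ring := P.isDVR

/-- The normalized discrete valuation at `P`, written multiplicatively. -/
noncomputable def valuation (P : Place K F) : Valuation F (WithZero (Multiplicative ℤ)) :=
  (IsDiscreteValuationRing.maximalIdeal P.ring).valuation F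

/-- The order `v_P(z)` of a nonzero function `z` at `P`, normalized to have value group `ℤ`
(with the junk value `0` at `z = 0`). -/
noncomputable def ord (P : Place K F) (z : F) : ℤ := -WithZero.log (P.valuation z)

/-- The map from the constants to the residue class field `O_P / P`. -/
noncomputable def constToResidue (P : Place K F) : K →+* IsLocalRing.ResidueField P.ring :=
  (IsLocalRing.residue P.ring).comp ((algebraMap K F).codRestrict P.ring P.const_mem)

/-- The degree of `P`: the dimension of its residue class field over the constants. -/
noncomputable def degree (P : Place K F) : ℕ :=
  letI := P.constToResidue.toAlgebra
  Module.finrank K (IsLocalRing.ResidueField P.ring)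

/-- A rational place is a place of degree one. -/
def IsRational (P : Place K F) : Prop := P.degree = 1

open Classical in
/-- The value `z(P)` of a function `z` regular at a rational place `P`: the constant `a` such
that `z - a` lies in the maximal ideal of `O_P` (and `0` if there is no such constant). -/
noncomputable def value (P : Place K F) (z : F) : K :=
  if h : ∃ a : K, z - algebraMap K F a ∈ P.ring.nonunits then h.choose else 0

/-- The pole divisor `(z)_∞` of a nonzero function `z`, as the function that maps each place to
its multiplicity. -/
noncomputable def poleDivisor (z : F) : Place K F → ℤ := fun P => max 0 (-P.ord z)

/-- The image `φ(P)` of a place under an automorphism; its valuation ring is `φ(O_P)`. -/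
def map (φ : F ≃ₐ[K] F) (P : Place K F) : Place K F where
  ring := P.ring.comap (φ.symm : F →+* F)
  const_mem a := by
    simpa [ValuationSubring.mem_comap] using P.const_mem a
  isDVR :=
    let e : P.ring ≃+* P.ring.comap (φ.symm : F →+* F) :=
      { toFun := fun t => ⟨φ t, by simp [ValuationSubring.mem_comap]⟩
        invFun := fun t => ⟨φ.symm t, t.2⟩
        left_inv := fun t => by simp
        right_inv := fun t => by simp
        map_mul' := fun s t => by ext; simp
        map_add' := fun s t => by ext; simp }
    IsDiscreteValuationRing.RingEquivClass.isDiscreteValuationRing e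

/-- The orbit `{φ^j(P)}` of a place under the cyclic group generated by `φ`. -/
def orbit (φ : F ≃ₐ[K] F) (P : Place K F) : Set (Place K F) :=
  {R | ∃ j : ℤ, R = P.map (φ ^ j)}

end Place

end Places

section Hermitian

/-- The polynomial `Y^q + Y - x^(q+1)` over the rational function field `K(x)`. -/
noncomputable def hermitianPolynomial (K : Type*) [Field K] (q : ℕ) : (RatFunc K)[X] :=
  X ^ q + X - C (RatFunc.X ^ (q + 1))

theorem hermitianPolynomial_irreducible (K : Type*) [Field K] (q : ℕ) (hq : 1 < q) :
    Irreducible (hermitianPolynomial K q) := by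
  -- the same curve, as a monic polynomial over `K[x]`
  have hmon : (X ^ q + X - C (X ^ (q + 1)) : K[X][X]).Monic := by
    rw [add_sub_assoc]
    refine monic_X_pow_add ((degree_X_sub_C_le _).trans_lt ?_)
    exact_mod_cast hq
  have hmap : hermitianPolynomial K q =
      (X ^ q + X - C (X ^ (q + 1)) : K[X][X]).map (algebraMap K[X] (RatFunc K)) := by
    simp [hermitianPolynomial]
  rw [hmap, ← hmon.irreducible_iff_irreducible_map_fraction_map]
  -- exchange the variables, and apply the Eisenstein criterion
  rw [← MulEquiv.irreducible_iff (Bivariate.swap (R := K)), ← (Associated.refl _).neg_left.irreducible_iff]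
  have hsw : -(Bivariate.swap (R := K) (X ^ q + X - C (X ^ (q + 1)))) =
      X ^ (q + 1) + C (-(X ^ q + X) : K[X]) := by
    simp only [map_sub, map_add, map_pow, Bivariate.swap_Y, Bivariate.swap_X, map_neg]
    ring
  rw [hsw]
  have hmon2 : (X ^ (q + 1) + C (-(X ^ q + X) : K[X])).Monic := monic_X_pow_add_C _ (by omega)
  have hdeg : (X ^ (q + 1) + C (-(X ^ q + X) : K[X])).natDegree = q + 1 :=
    natDegree_X_pow_add_C
  have hprime : (Ideal.span {(X : K[X])}).IsPrime :=
    (Ideal.span_singleton_prime X_ne_zero).2 prime_X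
  refine (hmon2.isEisensteinAt_of_mem_of_notMem hprime.ne_top ?_ ?_).irreducible hprime
    hmon2.isPrimitive (by omega)
  · intro n hn
    rw [hdeg] at hn
    rw [coeff_add, coeff_X_pow, if_neg (by omega), coeff_C, zero_add]
    split_ifs
    · rw [Ideal.mem_span_singleton, X_dvd_iff]
      simp [coeff_X_pow, show 0 ≠ q by omega]
    · exact zero_mem _
  · rw [Ideal.span_singleton_pow, Ideal.mem_span_singleton, coeff_add, coeff_X_pow,
      if_neg (by omega), coeff_C_zero, zero_add, dvd_neg, X_pow_dvd_iff]
    intro h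
    simpa [coeff_X_pow, show 1 ≠ q by omega] using h 1 (by norm_num)

instance (K : Type*) [Field K] (q : ℕ) [h : Fact (1 < q)] :
    Fact (Irreducible (hermitianPolynomial K q)) :=
  ⟨hermitianPolynomial_irreducible K q h.out⟩

/-- The Hermitian function field `H = K(x, y)`, `y^q + y = x^(q+1)`. -/
abbrev HermitianField (K : Type*) [Field K] (q : ℕ) : Type _ :=
  AdjoinRoot (hermitianPolynomial K q)

namespace HermitianField

variable (K : Type*) [Field K] (q : ℕ)

/-- The function `x`. -/
noncomputable def x : HermitianField K q := AdjoinRoot.of _ RatFunc.X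

/-- The function `y`. -/
noncomputable def y : HermitianField K q := AdjoinRoot.root _

end HermitianField

/-- The places `P` and `Q_{i,l}` label all the orbits of `φ` on the rational places other than
`P_∞`: they are rational places `≠ P_∞`, and each rational place `≠ P_∞` lies in exactly one
of the listed orbits (the index `none` stands for `P`, and `some (i, l)` for `Q_{i,l}`). -/
def LabelsOrbits {K F : Type*} [Field K] [Field F] [Algebra K F] {N M : ℕ}
    (φ : F ≃ₐ[K] F) (Pinf P : Place K F) (Q : Fin N → Fin M → Place K F) : Prop :=
  let A : Option (Fin N × Fin M) → Place K F := fun o => o.elim P fun il => Q il.1 il.2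
  (∀ o, (A o).IsRational ∧ A o ≠ Pinf) ∧
    ∀ R : Place K F, R.IsRational → R ≠ Pinf → ∃! o, R ∈ (A o).orbit φ

/-- The multisequence `s_i = (z(Q_{i,1}), z(φ(Q_{i,1})), …, z(φ^(p-1)(Q_{i,1})), …,
z(Q_{i,M}), …, z(φ^(p-1)(Q_{i,M})))` of length `M p`: the term of index `l p + j`, with
`0 ≤ l < M` and `0 ≤ j < p`, is the value of `z` at the image under `φ^j` of the
`(l+1)`-st place of the `i`-th family. -/
noncomputable def orbitMultisequence {K F : Type*} [Field K] [Field F] [Algebra K F]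
    {N M : ℕ} (p : ℕ) (φ : F ≃ₐ[K] F) (Q : Fin N → Fin M → Place K F) (z : F) :
    Fin N → Fin (M * p) → K :=
  fun i t => ((Q i t.divNat).map (φ ^ (t.modNat : ℕ))).value z

end Hermitian

/-! ### Valuations, residues and values at a place -/

namespace Place

open scoped WithZero
open WithZero

variable {K F : Type*} [Field K] [Field F] [Algebra K F]

/-! The terms of the sequences are values of z at pairwise distinct rational places, all different
from P_∞ and outside the orbit of P (`orbitPlace_injective`, `LabelsOrbits.map_orbitPlace_ne`). If
the first n terms of each sequence vanish, z has nN zeros but at most k + 1 ≤ q² - q poles, which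
gives (a).

For (b), suppose that f generates the sequences with u < p variables. Since z(φ^t(R)) =
(φ^{-t}z)(R), the function W = φ^{-u}z - f(z, φ^{-1}z, …, φ^{-(u-1)}z) vanishes at the place of each
term from which the recursion stays inside one block of length p. It is not zero: at φ^{-u}(P) only
its first summand has a pole, because u < p. Its poles have order at most kru at P_∞, r at each
φ^{-t}(P) with t < u, and 1 at φ^{-u}(P), in total (k+1)ru + 1 (`card_le_of_value_eq_eval`). Each
sequence has n - u such starting terms if n ≤ p, and at least ⌊n/p⌋(p - u) if n ≥ p; comparing the
counts and solving for u gives the bounds. The cases u = n and u ≥ p are immediate.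

That zeros do not outnumber poles (`Place.card_zeros_le`) comes from a dimension count. With D₁ a
large multiple of P_∞ and E the bound on the poles of W, multiplication by W embeds L(D₁) into the
kernel of the evaluation L(D₁ + E) → K^Z. That evaluation is onto, and dim L(D₁ + E) ≤ dim L(D₁) +
deg E, so |Z| ≤ deg E. Three facts on the Hermitian curve are needed: P_∞ is the only pole of x and
a rational place is determined by its values of x and y (`eq_of_pole`, `eq_of_value_eq`); hence
functions regular off P_∞ separate rational places (`exists_separating`); and such a function
vanishing at P_∞ is zero (`eq_zero_of_vanish_at_pole`), which makes the spaces finite-dimensional.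
-/

theorem valuation_le_one_iff (P : Place K F) {h : F} : P.valuation h ≤ 1 ↔ h ∈ P.ring := by
  constructor
  · intro H
    obtain ⟨a, rfl⟩ := IsDiscreteValuationRing.exists_lift_of_le_one H
    exact a.2
  · intro H
    exact IsDedekindDomain.HeightOneSpectrum.valuation_le_one _ (⟨h, H⟩ : P.ring)

theorem valuation_lt_one_iff (P : Place K F) {h : F} :
    P.valuation h < 1 ↔ h ∈ P.ring.nonunits := by
  have heq : P.valuation.IsEquiv P.ring.valuation := by
    rw [Valuation.isEquiv_iff_val_le_one]
    intro x
    rw [valuation_le_one_iff, ValuationSubring.valuation_le_one_iff]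
  rw [ValuationSubring.mem_nonunits_iff]
  exact (Valuation.isEquiv_iff_val_lt_one.1 heq)

theorem valuation_surjective (P : Place K F) : Function.Surjective P.valuation :=
  IsDedekindDomain.HeightOneSpectrum.valuation_surjective _ _

theorem ring_injective : Function.Injective (Place.ring : Place K F → ValuationSubring F) :=
  fun _ _ h => Place.ext h

theorem valuation_algebraMap_le_one (P : Place K F) (a : K) :
    P.valuation (algebraMap K F a) ≤ 1 := P.valuation_le_one_iff.2 (P.const_mem a)

theorem valuation_algebraMap (P : Place K F) {a : K} (ha : a ≠ 0) :
    P.valuation (algebraMap K F a) = 1 := by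
  refine le_antisymm (P.valuation_algebraMap_le_one a) ?_
  have h := P.valuation_algebraMap_le_one a⁻¹
  rw [map_inv₀, map_inv₀] at h
  have h0 : P.valuation (algebraMap K F a) ≠ 0 := by simpa using ha
  exact (inv_le_one₀ (zero_lt_iff.2 h0)).1 h

/-- Discrete valuations with value group `ℤ` are determined by their valuation rings. -/
theorem _root_.Valuation.eq_of_le_one_iff {v w : Valuation F ℤᵐ⁰} (hv : Function.Surjective v)
    (hw : Function.Surjective w) (h : ∀ x, v x ≤ 1 ↔ w x ≤ 1) : v = w := by
  have heq : v.IsEquiv w := Valuation.isEquiv_iff_val_le_one.2 (h _)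
  have hone : ∀ x, v x = 1 ↔ w x = 1 := fun x => Valuation.isEquiv_iff_val_eq_one.1 heq
  have hlt : ∀ x, v x < 1 ↔ w x < 1 := fun x => Valuation.isEquiv_iff_val_lt_one.1 heq
  obtain ⟨π, hπ⟩ := hv (exp (-1))
  have hπ0 : π ≠ 0 := by rintro rfl; exact exp_ne_zero (hπ.symm.trans (map_zero v))
  have hwπ0 : w π ≠ 0 := by simpa using hπ0
  have hπn : ∀ n : ℤ, v (π ^ n) = exp (-n) := by
    intro n
    rw [map_zpow₀, hπ, ← exp_zsmul]; simp
  have key : ∀ x (n : ℤ), v x = exp n → w x = exp (-n * log (w π)) := by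
    intro x n hx
    have h1 : v (x * π ^ n) = 1 := by rw [map_mul, hx, hπn, ← exp_add]; simp
    rw [hone, map_mul, map_zpow₀] at h1
    rw [eq_inv_of_mul_eq_one_left h1, ← zpow_neg]
    conv_lhs => rw [← exp_log hwπ0]
    rw [← exp_zsmul]; simp
  obtain ⟨x, hx⟩ := hw (exp 1)
  have hx0 : v x ≠ 0 := by
    intro h0
    rw [map_eq_zero] at h0
    rw [h0, map_zero] at hx
    exact exp_ne_zero hx.symm
  have h2 := key x _ (exp_log hx0).symm
  rw [hx, exp_inj] at h2
  have h3 : log (w π) < 0 := by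
    have : w π < 1 := (hlt π).1 (by rw [hπ, ← exp_zero, exp_lt_exp]; norm_num)
    rw [← exp_log hwπ0, ← exp_zero, exp_lt_exp] at this
    exact this
  have h4 : log (w π) = -1 := by
    rcases Int.eq_one_or_neg_one_of_mul_eq_one' h2.symm with h | h <;> omega
  ext x
  by_cases hx : v x = 0
  · rw [map_eq_zero] at hx
    simp [hx]
  · rw [key x _ (exp_log hx).symm, h4]; simp [exp_log hx]

/-- Both sides are surjective onto the value group and have the same valuation ring, which
determines a normalized discrete valuation. -/
theorem valuation_map (φ : F ≃ₐ[K] F) (P : Place K F) (h : F) :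
    (P.map φ).valuation h = P.valuation (φ.symm h) := by
  have : (P.map φ).valuation = P.valuation.comap (φ.symm : F →+* F) := by
    refine Valuation.eq_of_le_one_iff (valuation_surjective _) ?_ ?_
    · intro x
      obtain ⟨y, hy⟩ := P.valuation_surjective x
      exact ⟨φ y, by simp [Valuation.comap_apply, hy]⟩
    · intro x
      rw [valuation_le_one_iff]
      simp only [map, ValuationSubring.mem_comap, Valuation.comap_apply, valuation_le_one_iff]
  rw [this]; rfl

/-- Every residue class of `P` contains a constant. -/
def ConstResidues (P : Place K F) : Prop :=
  ∀ h, P.valuation h ≤ 1 → ∃ a : K, P.valuation (h - algebraMap K F a) < 1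

/-- If v spans the residue field over K, with a v the class of h and b v = 1, then the class of h is
a/b. This form of rationality is easy to transport along automorphisms and to check at P_∞. -/
theorem IsRational.constResidues {P : Place K F} (hP : P.IsRational) : P.ConstResidues := by
  intro h hh
  rw [valuation_le_one_iff] at hh
  let _ := P.constToResidue.toAlgebra
  have h1 : Module.finrank K (IsLocalRing.ResidueField P.ring) = 1 := hP
  obtain ⟨v, hv, hv'⟩ := finrank_eq_one_iff'.1 h1
  obtain ⟨a, ha⟩ := hv' (IsLocalRing.residue P.ring ⟨h, hh⟩)
  obtain ⟨b, hb⟩ := hv' 1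
  have hb0 : b ≠ 0 := by rintro rfl; simp at hb
  refine ⟨a / b, ?_⟩
  rw [valuation_lt_one_iff]
  have hav : P.constToResidue a * v = IsLocalRing.residue P.ring ⟨h, hh⟩ := ha
  have hbv : P.constToResidue b * v = 1 := hb
  have e : IsLocalRing.residue P.ring ⟨h, hh⟩ = P.constToResidue (a / b) := by
    have : P.constToResidue b ≠ 0 := by simpa using hb0
    rw [← hav, map_div₀, div_eq_mul_inv, eq_inv_of_mul_eq_one_right hbv]
  have e' : IsLocalRing.residue P.ring (⟨h, hh⟩ - ⟨algebraMap K F (a / b), P.const_mem _⟩) = 0 := by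
    rw [map_sub, e, sub_eq_zero]; rfl
  rw [IsLocalRing.residue_eq_zero_iff] at e'
  rw [ValuationSubring.mem_nonunits_iff_exists_mem_maximalIdeal]
  exact ⟨_, e'⟩

theorem ConstResidues.map {P : Place K F} (hP : P.ConstResidues) (φ : F ≃ₐ[K] F) :
    (P.map φ).ConstResidues := by
  intro h hh
  rw [valuation_map] at hh
  obtain ⟨a, ha⟩ := hP _ hh
  exact ⟨a, by rwa [valuation_map, map_sub, AlgEquiv.commutes]⟩

theorem residue_unique (P : Place K F) {h : F} {a b : K}
    (ha : P.valuation (h - algebraMap K F a) < 1) (hb : P.valuation (h - algebraMap K F b) < 1) :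
    a = b := by
  by_contra hab
  have h1 : P.valuation (algebraMap K F (a - b)) = 1 := P.valuation_algebraMap (sub_ne_zero.2 hab)
  have h2 : algebraMap K F (a - b) = (h - algebraMap K F b) - (h - algebraMap K F a) := by
    rw [map_sub]; ring
  have h3 := P.valuation.map_sub_lt hb ha
  rw [← h2, h1] at h3
  exact lt_irrefl _ h3

theorem value_eq (P : Place K F) {h : F} {a : K}
    (ha : P.valuation (h - algebraMap K F a) < 1) : P.value h = a := by
  have hex : ∃ a : K, h - algebraMap K F a ∈ P.ring.nonunits := ⟨a, P.valuation_lt_one_iff.1 ha⟩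
  rw [value, dif_pos hex]
  exact P.residue_unique (P.valuation_lt_one_iff.2 hex.choose_spec) ha

theorem ConstResidues.valuation_sub_value_lt {P : Place K F} (hP : P.ConstResidues) {h : F}
    (hh : P.valuation h ≤ 1) : P.valuation (h - algebraMap K F (P.value h)) < 1 := by
  obtain ⟨a, ha⟩ := hP h hh
  rwa [P.value_eq ha]

/-! ### Expansions at a smooth rational point of a plane curve -/

section LocalParameter

variable {s t : F}

theorem exists_const_add_of_mem_adjoin {f : F} (hf : f ∈ Algebra.adjoin K {s, t}) :
    ∃ c : K, ∃ f₁ ∈ Algebra.adjoin K {s, t}, ∃ f₂ ∈ Algebra.adjoin K {s, t},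
      f = algebraMap K F c + s * f₁ + t * f₂ := by
  induction hf using Algebra.adjoin_induction with
  | mem x hx =>
    rcases hx with rfl | hx
    · exact ⟨0, 1, one_mem _, 0, zero_mem _, by simp⟩
    · rw [Set.mem_singleton_iff] at hx
      subst hx
      exact ⟨0, 0, zero_mem _, 1, one_mem _, by simp⟩
  | algebraMap r => exact ⟨r, 0, zero_mem _, 0, zero_mem _, by simp⟩
  | add x y hx hy ihx ihy =>
    obtain ⟨c, f₁, h₁, f₂, h₂, rfl⟩ := ihx
    obtain ⟨c', g₁, k₁, g₂, k₂, rfl⟩ := ihy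
    exact ⟨c + c', f₁ + g₁, add_mem h₁ k₁, f₂ + g₂, add_mem h₂ k₂, by rw [map_add]; ring⟩
  | mul x y hx hy ihx ihy =>
    obtain ⟨c, f₁, h₁, f₂, h₂, h⟩ := ihx
    obtain ⟨c', g₁, k₁, g₂, k₂, k⟩ := ihy
    refine ⟨c * c', f₁ * y + algebraMap K F c * g₁, ?_, f₂ * y + algebraMap K F c * g₂, ?_, ?_⟩
    · exact add_mem (mul_mem h₁ hy) (mul_mem (Subalgebra.algebraMap_mem _ _) k₁)
    · exact add_mem (mul_mem h₂ hy) (mul_mem (Subalgebra.algebraMap_mem _ _) k₂)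
    · rw [map_mul]
      linear_combination y * h + algebraMap K F c * k

variable (K s t) in
/-- The elements that are congruent to `1` at every place where `s` and `t` vanish. -/
def OneUnits : Set F :=
  {u | ∀ P : Place K F, P.valuation s < 1 → P.valuation t < 1 → P.valuation (u - 1) < 1}

theorem _root_.Valuation.eq_one_of_sub_one_lt {v : Valuation F ℤᵐ⁰} {u : F} (h : v (u - 1) < 1) :
    v u = 1 := by
  have := v.map_add_eq_of_lt_right (x := u - 1) (y := 1) (by simpa using h)
  simpa using this

theorem mul_mem_oneUnits {u w : F} (hu : u ∈ OneUnits K s t) (hw : w ∈ OneUnits K s t) :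
    u * w ∈ OneUnits K s t := by
  intro P hs ht
  have h1 := hu P hs ht
  have h2 := hw P hs ht
  have : u * w - 1 = (u - 1) * w + (w - 1) := by ring
  rw [this]
  refine P.valuation.map_add_lt ?_ h2
  rwa [map_mul, Valuation.eq_one_of_sub_one_lt h2, mul_one]

theorem inv_mem_oneUnits {u : F} (h0 : u ≠ 0) (hu : u ∈ OneUnits K s t) :
    u⁻¹ ∈ OneUnits K s t := by
  intro P hs ht
  have h1 := hu P hs ht
  have : u⁻¹ - 1 = -(u - 1) * u⁻¹ := by field_simp; ring
  rw [this, map_mul, Valuation.map_neg, map_inv₀, Valuation.eq_one_of_sub_one_lt h1]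
  simpa using h1

theorem valuation_le_one_of_mem_adjoin (P : Place K F) {S : Set F}
    (hS : ∀ x ∈ S, P.valuation x ≤ 1) {f : F} (hf : f ∈ Algebra.adjoin K S) :
    P.valuation f ≤ 1 := by
  induction hf using Algebra.adjoin_induction with
  | mem x hx => exact hS x hx
  | algebraMap r => exact P.valuation_algebraMap_le_one r
  | add x y hx hy ihx ihy => exact P.valuation.map_add_le ihx ihy
  | mul x y hx hy ihx ihy => rw [map_mul]; exact mul_le_one' ihx ihy

theorem one_add_mem_oneUnits {f₁ f₂ : F} (h₁ : f₁ ∈ Algebra.adjoin K {s, t})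
    (h₂ : f₂ ∈ Algebra.adjoin K {s, t}) : 1 + s * f₁ + t * f₂ ∈ OneUnits K s t := by
  intro P hs ht
  have hA : ∀ f ∈ Algebra.adjoin K {s, t}, P.valuation f ≤ 1 := fun f hf =>
    P.valuation_le_one_of_mem_adjoin (by rintro x (rfl | rfl); exacts [hs.le, ht.le]) hf
  have : 1 + s * f₁ + t * f₂ - 1 = s * f₁ + t * f₂ := by ring
  rw [this]
  refine P.valuation.map_add_lt ?_ ?_ <;> rw [map_mul]
  · exact mul_lt_one_of_lt_of_le hs (hA _ h₁)
  · exact mul_lt_one_of_lt_of_le ht (hA _ h₂)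

variable {d e : F}

/-- An element with nonzero constant term is a constant times a one-unit; otherwise the relation
allows a factor t to be split off. The order at `P` drops each time, so `N` bounds the number of
steps. One-units refer to all places where s and t vanish, so the expansion found at `P` is valid at
every such place. -/
theorem exists_expansion_of_mem_adjoin (hd : d ∈ Algebra.adjoin K {s, t})
    (he : e ∈ Algebra.adjoin K {s, t}) (hrel : s * (1 + s * e) = t * d) (P : Place K F)
    (hs : P.valuation s < 1) (ht : P.valuation t < 1) (N : ℕ) :
    ∀ f ∈ Algebra.adjoin K {s, t}, f ≠ 0 → exp (-(N : ℤ)) ≤ P.valuation f →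
      ∃ (n : ℕ) (c : K) (u : F), c ≠ 0 ∧ u ∈ OneUnits K s t ∧ f = algebraMap K F c * t ^ n * u := by
  have hA : ∀ f ∈ Algebra.adjoin K {s, t}, P.valuation f ≤ 1 := fun f hf =>
    P.valuation_le_one_of_mem_adjoin (by rintro x (rfl | rfl); exacts [hs.le, ht.le]) hf
  have hse : 1 + s * e ∈ OneUnits K s t := by
    simpa using one_add_mem_oneUnits he (zero_mem (Algebra.adjoin K {s, t}))
  have hse1 := Valuation.eq_one_of_sub_one_lt (hse P hs ht)
  have hse0 : 1 + s * e ≠ 0 := by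
    intro h; rw [h] at hse1; simp at hse1
  have hsm : s ∈ Algebra.adjoin K {s, t} := Algebra.subset_adjoin (by simp)
  induction N with
  | zero =>
    intro f hf hf0 hv
    obtain ⟨c, f₁, h₁, f₂, h₂, hfe⟩ := exists_const_add_of_mem_adjoin hf
    by_cases hc : c = 0
    · exfalso
      have : P.valuation f < 1 := by
        rw [hfe, hc, map_zero, zero_add]
        refine P.valuation.map_add_lt ?_ ?_ <;> rw [map_mul]
        · exact mul_lt_one_of_lt_of_le hs (hA _ h₁)
        · exact mul_lt_one_of_lt_of_le ht (hA _ h₂)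
      simp at hv
      exact absurd hv (not_le.2 this)
    · refine ⟨0, c, 1 + s * (algebraMap K F c⁻¹ * f₁) + t * (algebraMap K F c⁻¹ * f₂), hc,
        one_add_mem_oneUnits (mul_mem (Subalgebra.algebraMap_mem _ _) h₁)
          (mul_mem (Subalgebra.algebraMap_mem _ _) h₂), ?_⟩
      have : algebraMap K F c ≠ 0 := by simpa using hc
      rw [hfe, map_inv₀]; field_simp
  | succ N ih =>
    intro f hf hf0 hv
    obtain ⟨c, f₁, h₁, f₂, h₂, hfe⟩ := exists_const_add_of_mem_adjoin hf
    by_cases hc : c = 0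
    -- Multiplying s f₁ + t f₂ by the one-unit 1 + s e turns s into t d, so that t divides the
    -- result within K[s, t].
    · have hg : d * f₁ + (1 + s * e) * f₂ ∈ Algebra.adjoin K {s, t} :=
        add_mem (mul_mem hd h₁) (mul_mem (add_mem (one_mem _) (mul_mem hsm he)) h₂)
      have hfg : f * (1 + s * e) = t * (d * f₁ + (1 + s * e) * f₂) := by
        rw [hfe, hc, map_zero]; linear_combination f₁ * hrel
      have hg0 : d * f₁ + (1 + s * e) * f₂ ≠ 0 := by
        intro h
        rw [h, mul_zero] at hfg
        exact (mul_ne_zero hf0 hse0) hfg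
      have hv' : exp (-(N : ℤ)) ≤ P.valuation (d * f₁ + (1 + s * e) * f₂) := by
        have h1 := congrArg P.valuation hfg
        rw [map_mul, map_mul, hse1, mul_one] at h1
        have ht0 : P.valuation t ≠ 0 := by
          intro h
          rw [h, zero_mul] at h1
          simp [hf0] at h1
        have ht1 : P.valuation t ≤ exp (-1) := by
          rw [← exp_log ht0, ← exp_zero, exp_lt_exp] at ht
          rw [← exp_log ht0, exp_le_exp]; omega
        rw [h1] at hv
        have h2 : exp (-(N + 1 : ℕ) : ℤ) ≤
            exp (-1) * P.valuation (d * f₁ + (1 + s * e) * f₂) :=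
          hv.trans (mul_le_mul_left ht1 _)
        have h3 : exp (-(N + 1 : ℕ) : ℤ) = exp (-1 : ℤ) * exp (-(N : ℤ)) := by
          rw [← exp_add]; congr 1; push_cast; ring
        rw [h3] at h2
        exact (mul_le_mul_iff_right₀ (zero_lt_iff.2 exp_ne_zero)).1 h2
      obtain ⟨n, c', u, hc', hu, hgu⟩ := ih _ hg hg0 hv'
      refine ⟨n + 1, c', u * (1 + s * e)⁻¹, hc', mul_mem_oneUnits hu (inv_mem_oneUnits hse0 hse), ?_⟩
      rw [hgu] at hfg
      rw [← mul_assoc, ← div_eq_mul_inv, eq_div_iff hse0, hfg]; ring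
    · refine ⟨0, c, 1 + s * (algebraMap K F c⁻¹ * f₁) + t * (algebraMap K F c⁻¹ * f₂), hc,
        one_add_mem_oneUnits (mul_mem (Subalgebra.algebraMap_mem _ _) h₁)
          (mul_mem (Subalgebra.algebraMap_mem _ _) h₂), ?_⟩
      have : algebraMap K F c ≠ 0 := by simpa using hc
      rw [hfe, map_inv₀]; field_simp

/-- At a place where the generators `s` and `t` of the function field vanish, and where the curve
is smooth with tangent direction given by `s (1 + s e) = t d`, every function is a power of `t`
times a constant times a one-unit. -/
theorem exists_expansion (hgen : IntermediateField.adjoin K {s, t} = ⊤)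
    (hd : d ∈ Algebra.adjoin K {s, t})
    (he : e ∈ Algebra.adjoin K {s, t}) (hrel : s * (1 + s * e) = t * d) (P : Place K F)
    (hs : P.valuation s < 1) (ht : P.valuation t < 1) {h : F} (hh : h ≠ 0) :
    ∃ (n : ℤ) (c : K) (u : F), c ≠ 0 ∧ u ∈ OneUnits K s t ∧ h = algebraMap K F c * t ^ n * u := by
  have hA : ∀ f ∈ Algebra.adjoin K {s, t}, P.valuation f ≤ 1 := fun f hf =>
    P.valuation_le_one_of_mem_adjoin (by rintro x (rfl | rfl); exacts [hs.le, ht.le]) hf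
  have key : ∀ f ∈ Algebra.adjoin K {s, t}, f ≠ 0 →
      ∃ (n : ℕ) (c : K) (u : F), c ≠ 0 ∧ u ∈ OneUnits K s t ∧
        f = algebraMap K F c * t ^ n * u := by
    intro f hf hf0
    refine exists_expansion_of_mem_adjoin hd he hrel P hs ht
      (log (P.valuation f)).natAbs f hf hf0 ?_
    have hv0 : P.valuation f ≠ 0 := by simpa using hf0
    conv_rhs => rw [← exp_log hv0]
    rw [exp_le_exp]; omega
  have hmem : h ∈ IntermediateField.adjoin K {s, t} := by rw [hgen]; trivial
  obtain ⟨f, hf, g, hg, rfl⟩ := IntermediateField.mem_adjoin_iff_div.1 hmem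
  obtain ⟨hf0, hg0⟩ : f ≠ 0 ∧ g ≠ 0 := by simpa using hh
  obtain ⟨n, c, u, hc, hu, rfl⟩ := key f hf hf0
  obtain ⟨n', c', u', hc', hu', rfl⟩ := key g hg hg0
  -- Subtracting exponents needs t ≠ 0; if t = 0, both exponents vanish because numerator and
  -- denominator are nonzero.
  have ht0 : t ≠ 0 ∨ (n = 0 ∧ n' = 0) := by
    by_cases h : t = 0
    · right
      subst h
      refine ⟨?_, ?_⟩
      · by_contra h; simp [h] at hf0
      · by_contra h; simp [h] at hg0
    · exact Or.inl h
  have hu0 : u' ≠ 0 := by rintro rfl; simp at hg0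
  refine ⟨n - n', c / c', u * u'⁻¹, div_ne_zero hc hc', mul_mem_oneUnits hu
    (inv_mem_oneUnits hu0 hu'), ?_⟩
  rcases ht0 with ht0 | ⟨rfl, rfl⟩
  · rw [zpow_sub₀ ht0, map_div₀]
    simp only [zpow_natCast]
    field_simp
  · simp only [map_div₀]
    simp
    field_simp

theorem valuation_expansion (P : Place K F) (hs : P.valuation s < 1) (ht : P.valuation t < 1)
    {n : ℤ} {c : K} {u : F} (hc : c ≠ 0) (hu : u ∈ OneUnits K s t) :
    P.valuation (algebraMap K F c * t ^ n * u) = P.valuation t ^ n := by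
  rw [map_mul, map_mul, P.valuation_algebraMap hc, map_zpow₀,
    Valuation.eq_one_of_sub_one_lt (hu P hs ht)]
  simp

variable (hgen : IntermediateField.adjoin K {s, t} = ⊤) (hd : d ∈ Algebra.adjoin K {s, t})
    (he : e ∈ Algebra.adjoin K {s, t}) (hrel : s * (1 + s * e) = t * d)
include hgen hd he hrel

/-- The expansion of a function of order 1 gives n · v(t) = 1 in ℤ, and v(t) > 0. -/
theorem valuation_eq_exp_neg_one (P : Place K F) (hs : P.valuation s < 1)
    (ht : P.valuation t < 1) : P.valuation t = exp (-1) := by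
  obtain ⟨h, hh⟩ := P.valuation_surjective (exp (-1))
  have h0 : h ≠ 0 := by rintro rfl; exact exp_ne_zero (hh.symm.trans (map_zero _))
  obtain ⟨n, c, u, hc, hu, rfl⟩ := exists_expansion hgen hd he hrel P hs ht h0
  rw [valuation_expansion P hs ht hc hu] at hh
  have ht0 : P.valuation t ≠ 0 := by
    intro h
    rw [h] at hh
    by_cases hn : n = 0
    · subst hn
      rw [zpow_zero, ← exp_zero, exp_inj] at hh
      omega
    · rw [zero_zpow _ hn] at hh
      exact exp_ne_zero hh.symm
  rw [← exp_log ht0, ← exp_zsmul, exp_inj, smul_eq_mul] at hh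
  rw [← exp_log ht0, ← exp_zero, exp_lt_exp] at ht
  rw [← exp_log ht0, exp_inj]
  have : n * -log (P.valuation t) = 1 := by linarith
  rcases Int.eq_one_or_neg_one_of_mul_eq_one' this with h | h <;> omega

/-- One expansion c tⁿ u serves both places, and t has order 1 at both, so the order of every
function is n at each of them. -/
theorem eq_of_vanish (P P' : Place K F) (hs : P.valuation s < 1)
    (ht : P.valuation t < 1) (hs' : P'.valuation s < 1) (ht' : P'.valuation t < 1) : P = P' := by
  apply ring_injective
  ext h
  rw [← valuation_le_one_iff, ← valuation_le_one_iff]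
  by_cases hh : h = 0
  · simp [hh]
  obtain ⟨n, c, u, hc, hu, rfl⟩ := exists_expansion hgen hd he hrel P hs ht hh
  rw [valuation_expansion P hs ht hc hu, valuation_expansion P' hs' ht' hc hu,
    valuation_eq_exp_neg_one hgen hd he hrel P hs ht,
    valuation_eq_exp_neg_one hgen hd he hrel P' hs' ht']

theorem constResidues_of_vanish (P : Place K F) (hs : P.valuation s < 1)
    (ht : P.valuation t < 1) : P.ConstResidues := by
  intro h hv
  by_cases hh : h = 0
  · exact ⟨0, by simp [hh]⟩
  obtain ⟨n, c, u, hc, hu, rfl⟩ := exists_expansion hgen hd he hrel P hs ht hh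
  by_cases hn : n = 0
  · refine ⟨c, ?_⟩
    have : algebraMap K F c * t ^ n * u - algebraMap K F c = algebraMap K F c * (u - 1) := by
      rw [hn]; simp; ring
    rw [this, map_mul, P.valuation_algebraMap hc, one_mul]
    exact hu P hs ht
  · refine ⟨0, ?_⟩
    rw [map_zero, sub_zero]
    refine lt_of_le_of_ne hv ?_
    rw [valuation_expansion P hs ht hc hu, valuation_eq_exp_neg_one hgen hd he hrel P hs ht,
      ← exp_zsmul, ← exp_zero, ne_eq, exp_inj, smul_eq_mul]
    omega

end LocalParameter

end Place

/-! ### Riemann–Roch spaces, and zeros against poles -/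

namespace Place

open scoped WithZero
open WithZero

variable {K F : Type*} [Field K] [Field F] [Algebra K F]

theorem valuation_smul_le (P : Place K F) (a : K) (h : F) :
    P.valuation (a • h) ≤ P.valuation h := by
  rw [Algebra.smul_def, map_mul]
  exact mul_le_of_le_one_left' (P.valuation_algebraMap_le_one a)

theorem ConstResidues.value_add {P : Place K F} (hP : P.ConstResidues) {f g : F}
    (hf : P.valuation f ≤ 1) (hg : P.valuation g ≤ 1) :
    P.value (f + g) = P.value f + P.value g := by
  apply P.value_eq
  have : f + g - algebraMap K F (P.value f + P.value g) =
    (f - algebraMap K F (P.value f)) + (g - algebraMap K F (P.value g)) := by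
    rw [map_add]; ring
  rw [this]
  exact P.valuation.map_add_lt (hP.valuation_sub_value_lt hf) (hP.valuation_sub_value_lt hg)

theorem ConstResidues.value_smul {P : Place K F} (hP : P.ConstResidues) (a : K) {f : F}
    (hf : P.valuation f ≤ 1) : P.value (a • f) = a * P.value f := by
  apply P.value_eq
  have : a • f - algebraMap K F (a * P.value f) = a • (f - algebraMap K F (P.value f)) := by
    rw [map_mul, smul_sub, Algebra.smul_def, Algebra.smul_def]
  rw [this]
  exact (P.valuation_smul_le _ _).trans_lt (hP.valuation_sub_value_lt hf)

theorem ConstResidues.value_mul {P : Place K F} (hP : P.ConstResidues) {f g : F}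
    (hf : P.valuation f ≤ 1) (hg : P.valuation g ≤ 1) :
    P.value (f * g) = P.value f * P.value g := by
  apply P.value_eq
  have : f * g - algebraMap K F (P.value f * P.value g) =
    f * (g - algebraMap K F (P.value g)) +
      algebraMap K F (P.value g) * (f - algebraMap K F (P.value f)) := by
    rw [map_mul]; ring
  rw [this]
  refine P.valuation.map_add_lt ?_ ?_ <;> rw [map_mul, mul_comm]
  · exact mul_lt_one_of_lt_of_le (hP.valuation_sub_value_lt hg) hf
  · exact mul_lt_one_of_lt_of_le (hP.valuation_sub_value_lt hf) (P.valuation_algebraMap_le_one _)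

theorem value_algebraMap (P : Place K F) (a : K) : P.value (algebraMap K F a) = a :=
  P.value_eq (by simp)

theorem ConstResidues.value_pow {P : Place K F} (hP : P.ConstResidues) {f : F}
    (hf : P.valuation f ≤ 1) (n : ℕ) : P.value (f ^ n) = P.value f ^ n := by
  induction n with
  | zero => simpa using P.value_algebraMap (1 : K)
  | succ n ih =>
    rw [pow_succ, hP.value_mul _ hf, ih, pow_succ]
    rw [map_pow]
    exact pow_le_one' hf n

theorem ConstResidues.value_eq_zero_iff {P : Place K F} (hP : P.ConstResidues) {f : F}
    (hf : P.valuation f ≤ 1) : P.value f = 0 ↔ P.valuation f < 1 := by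
  constructor
  · intro h
    simpa [h] using hP.valuation_sub_value_lt hf
  · intro h
    exact P.value_eq (by simpa using h)

/-- The Riemann–Roch space of functions `h` with `v_P(h) ≥ -D(P)` for all places `P`. -/
def riemannRochSpace (D : Place K F → ℤ) : Submodule K F where
  carrier := {h | ∀ P : Place K F, P.valuation h ≤ exp (D P)}
  add_mem' hf hg P := P.valuation.map_add_le (hf P) (hg P)
  zero_mem' P := by simp
  smul_mem' a h hh P := (P.valuation_smul_le a h).trans (hh P)

/-- The value at `P`, as a linear map on a space of functions regular at `P` after multiplication
by `π`. -/
noncomputable def valueLinearMap (S : Submodule K F) (P : Place K F) (hP : P.ConstResidues) (π : F)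
    (hS : ∀ h ∈ S, P.valuation (π * h) ≤ 1) : S →ₗ[K] K where
  toFun h := P.value (π * h)
  map_add' f g := by
    rw [Submodule.coe_add, mul_add, hP.value_add (hS _ f.2) (hS _ g.2)]
  map_smul' a f := by
    rw [Submodule.coe_smul, mul_smul_comm, hP.value_smul _ (hS _ f.2)]
    rfl

/-- The kernel of ℓ embeds into A, and the image of ℓ is at most one-dimensional. -/
theorem _root_.Submodule.finite_and_finrank_le_of_functional {A B : Submodule K F} (ℓ : B →ₗ[K] K)
    (hℓ : ∀ h, ℓ h = 0 → (h : F) ∈ A) [Module.Finite K A] :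
    Module.Finite K B ∧ Module.finrank K B ≤ Module.finrank K A + 1 := by
  let ι : LinearMap.ker ℓ →ₗ[K] A :=
    (B.subtype.comp (LinearMap.ker ℓ).subtype).codRestrict A fun h => hℓ h.1 h.2
  have hι : Function.Injective ι := by
    intro f g h
    have h1 : ((f : B) : F) = ((g : B) : F) := congrArg (Subtype.val : A → F) h
    exact Subtype.ext (Subtype.ext h1)
  have hfin : Module.Finite K (LinearMap.ker ℓ) := Module.Finite.of_injective ι hι
  have hq : Module.Finite K (B ⧸ LinearMap.ker ℓ) :=
    Module.Finite.of_injective ((LinearMap.ker ℓ).liftQ ℓ le_rfl)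
      (LinearMap.ker_eq_bot.1 (Submodule.ker_liftQ_eq_bot _ _ _ le_rfl))
  have hB : Module.Finite K B := Module.Finite.of_submodule_quotient (LinearMap.ker ℓ)
  refine ⟨hB, ?_⟩
  have h1 := LinearMap.finrank_range_add_finrank_ker ℓ
  have h2 : Module.finrank K (LinearMap.range ℓ) ≤ 1 := by
    simpa using Submodule.finrank_le (LinearMap.range ℓ)
  have h3 := LinearMap.finrank_le_finrank_of_injective hι
  omega

theorem finite_and_finrank_riemannRochSpace_le {D D' : Place K F → ℤ} {P : Place K F}
    (hP : P.ConstResidues) (hD : D' P = D P + 1) (hD' : ∀ R, R ≠ P → D' R = D R)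
    [Module.Finite K (riemannRochSpace D)] :
    Module.Finite K (riemannRochSpace D') ∧
      Module.finrank K (riemannRochSpace D') ≤ Module.finrank K (riemannRochSpace D) + 1 := by
  -- With π of order D'(P), the value of π h at P is the leading coefficient of h; it vanishes
  -- exactly when the pole of h is one order smaller than D' allows.
  obtain ⟨π, hπ⟩ := P.valuation_surjective (exp (-D' P))
  have hle : ∀ h ∈ riemannRochSpace D', P.valuation (π * h) ≤ 1 := by
    intro h hh
    rw [map_mul, hπ]
    calc exp (-D' P) * P.valuation h ≤ exp (-D' P) * exp (D' P) := mul_le_mul_right (hh P) _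
      _ = 1 := by rw [← exp_add]; simp
  refine Submodule.finite_and_finrank_le_of_functional (valueLinearMap _ P hP π hle) ?_
  intro h hh R
  by_cases hR : R = P
  · subst hR
    have h1 := (hP.value_eq_zero_iff (hle h h.2)).1 hh
    by_cases h0 : (h : F) = 0
    · simp [h0]
    have hv0 : R.valuation (h : F) ≠ 0 := by simpa using h0
    rw [map_mul, hπ, ← exp_log hv0, ← exp_add, ← exp_zero, exp_lt_exp] at h1
    rw [← exp_log hv0, exp_le_exp]
    omega
  · rw [← hD' R hR]
    exact h.2 R

open Classical in
theorem finite_and_finrank_riemannRochSpace_add_le {D : Place K F → ℤ}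
    [Module.Finite K (riemannRochSpace D)] (E : Multiset (Place K F))
    (hE : ∀ P ∈ E, P.ConstResidues) :
    Module.Finite K (riemannRochSpace fun P => D P + E.count P) ∧
      Module.finrank K (riemannRochSpace fun P => D P + E.count P) ≤
        Module.finrank K (riemannRochSpace D) + E.card := by
  induction E using Multiset.induction with
  | empty =>
    have : (fun P => D P + (((0 : Multiset (Place K F)).count P : ℕ) : ℤ)) = D := by ext; simp
    rw [this]
    exact ⟨inferInstance, le_rfl⟩
  | cons P E ih =>
    obtain ⟨h1, h2⟩ := ih fun R hR => hE R (Multiset.mem_cons_of_mem hR)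
    obtain ⟨h3, h4⟩ := finite_and_finrank_riemannRochSpace_le
      (D := fun P => D P + E.count P) (D' := fun R => D R + (P ::ₘ E).count R)
      (hE P (Multiset.mem_cons_self P E)) (by simp; ring)
      (fun R hR => by simp [Multiset.count_cons_of_ne hR])
    refine ⟨h3, h4.trans ?_⟩
    rw [Multiset.card_cons]
    omega

/-- A nonzero function has at most as many zeros as poles. Here the functions without poles away
from `P_∞` are supposed to separate the zeros, and to be trivial if they vanish at `P_∞`. -/
theorem card_zeros_le {Pinf : Place K F} (hinf : Pinf.ConstResidues)
    (htriv : ∀ h, (∀ R, R ≠ Pinf → R.valuation h ≤ 1) → Pinf.valuation h < 1 → h = 0)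
    (Z : Finset (Place K F)) (hZ : ∀ R ∈ Z, R.ConstResidues) (hinfZ : Pinf ∉ Z)
    (hsep : ∀ R ∈ Z, ∃ e : F, (∀ R', R' ≠ Pinf → R'.valuation e ≤ 1) ∧ R.valuation (e - 1) < 1 ∧
      ∀ R' ∈ Z, R' ≠ R → R'.valuation e < 1)
    (E : Multiset (Place K F)) (hE : ∀ R ∈ E, R.ConstResidues) (hZE : ∀ R ∈ Z, R ∉ E)
    {W : F} (hW : W ≠ 0) (hWE : ∀ R, R.valuation W ≤ 1 ∨ ∃ n : ℕ, R.valuation W ≤ exp (n : ℤ) ∧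
      Multiset.replicate n R ≤ E)
    (hWZ : ∀ R ∈ Z, R.valuation W < 1) : Z.card ≤ E.card := by
  classical
  have hWE' : ∀ R, R.valuation W ≤ exp (E.count R : ℤ) := by
    intro R
    rcases hWE R with h | ⟨n, h, hn⟩
    · refine h.trans ?_
      rw [← exp_zero, exp_le_exp]
      positivity
    · refine h.trans ?_
      rw [exp_le_exp]
      exact_mod_cast Multiset.le_count_iff_replicate_le.2 hn
  choose! e he1 he2 he3 using hsep
  -- n P_∞ must be large enough for its space to contain all the separating functions.
  obtain ⟨n, hn⟩ : ∃ n : ℕ, ∀ R ∈ Z, Pinf.valuation (e R) ≤ exp (n : ℤ) := by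
    refine ⟨Z.sup fun R => (log (Pinf.valuation (e R))).toNat, fun R hR => ?_⟩
    by_cases h0 : Pinf.valuation (e R) = 0
    · simp [h0]
    rw [← exp_log h0, exp_le_exp]
    have := Finset.le_sup (f := fun R => (log (Pinf.valuation (e R))).toNat) hR
    omega
  -- L(-P_∞) = 0 is the finite-dimensional start; n + 1 added points lead to D₁ = n P_∞, and E leads
  -- on to D₂.
  let D₀ : Place K F → ℤ := fun R => if R = Pinf then -1 else 0
  have hD₀ : riemannRochSpace D₀ = ⊥ := by
    rw [eq_bot_iff]
    intro h hh
    refine htriv h (fun R hR => ?_) ?_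
    · simpa [D₀, hR] using hh R
    · refine lt_of_le_of_lt (hh Pinf) ?_
      rw [← exp_zero, exp_lt_exp]
      simp [D₀]
  have : Module.Finite K (riemannRochSpace D₀) := by rw [hD₀]; infer_instance
  let D₁ : Place K F → ℤ := fun R => D₀ R + (Multiset.replicate (n + 1) Pinf).count R
  obtain ⟨hD₁, -⟩ := finite_and_finrank_riemannRochSpace_add_le (D := D₀)
    (Multiset.replicate (n + 1) Pinf) (fun P hP => by rwa [Multiset.eq_of_mem_replicate hP])
  change Module.Finite K (riemannRochSpace D₁) at hD₁
  have hD₁inf : D₁ Pinf = n := by simp [D₁, D₀]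
  have hD₁ne : ∀ R, R ≠ Pinf → D₁ R = 0 := by
    intro R hR
    simp [D₁, D₀, hR, Multiset.count_replicate, hR.symm]
  let D₂ : Place K F → ℤ := fun R => D₁ R + E.count R
  obtain ⟨hD₂, hrank⟩ := finite_and_finrank_riemannRochSpace_add_le (D := D₁) E hE
  change Module.Finite K (riemannRochSpace D₂) at hD₂
  change Module.finrank K (riemannRochSpace D₂) ≤ _ at hrank
  have hD₂Z : ∀ R ∈ Z, D₂ R = 0 := by
    intro R hR
    simp [D₂, hD₁ne R (by rintro rfl; exact hinfZ hR), hZE R hR]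
  have hreg : ∀ R ∈ Z, ∀ h ∈ riemannRochSpace D₂, R.valuation h ≤ 1 := by
    intro R hR h hh
    simpa [hD₂Z R hR] using hh R
  let ev : riemannRochSpace D₂ →ₗ[K] (Z → K) := LinearMap.pi fun R =>
    valueLinearMap _ R.1 (hZ R.1 R.2) 1 (fun h hh => by rw [one_mul]; exact hreg R.1 R.2 h hh)
  have hev : ∀ h R, ev h R = R.1.value (h : F) := fun h R => by
    simp [ev, valueLinearMap]
  -- The separating functions are mapped to the standard basis of K^Z.
  have hsurj : Function.Surjective ev := by
    have hmem : ∀ R ∈ Z, e R ∈ riemannRochSpace D₂ := by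
      intro R hR R'
      by_cases h : R' = Pinf
      · subst h
        refine (hn R hR).trans ?_
        rw [exp_le_exp]
        simp [D₂, hD₁inf]
      · refine (he1 R hR R' h).trans ?_
        rw [← exp_zero, exp_le_exp]
        simp [D₂, hD₁ne R' h]
    have hbasis : ∀ R : Z, ev ⟨e R, hmem R R.2⟩ = Pi.single R 1 := by
      intro R
      ext R'
      rw [hev]
      by_cases h : R' = R
      · subst h
        rw [Pi.single_eq_same]
        exact value_eq _ (by simpa using he2 R' R'.2)
      · rw [Pi.single_eq_of_ne h]
        exact value_eq _ (by simpa using he3 R R.2 R' R'.2 (fun h' => h (Subtype.ext h')))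
    rw [← LinearMap.range_eq_top, eq_top_iff, ← Module.Basis.span_eq (Pi.basisFun K Z),
      Submodule.span_le]
    rintro _ ⟨R, rfl⟩
    rw [Pi.basisFun_apply]
    exact ⟨_, hbasis R⟩
  have hker : Module.finrank K (LinearMap.ker ev) + Z.card =
      Module.finrank K (riemannRochSpace D₂) := by
    rw [← LinearMap.finrank_range_add_finrank_ker ev, LinearMap.range_eq_top.2 hsurj, finrank_top,
      Module.finrank_fintype_fun_eq_card, Fintype.card_coe, add_comm]
  have hmulmem : ∀ h ∈ riemannRochSpace D₁, W * h ∈ riemannRochSpace D₂ := by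
    intro h hh R
    rw [map_mul]
    calc R.valuation W * R.valuation h ≤ exp (E.count R : ℤ) * exp (D₁ R) :=
          mul_le_mul' (hWE' R) (hh R)
      _ = exp (D₂ R) := by rw [← exp_add, add_comm]
  -- Multiplication by W raises the allowed poles by E and kills the values on Z. Its injectivity
  -- gives dim L(D₁) ≤ dim L(D₂) - |Z| ≤ dim L(D₁) + |E| - |Z|.
  let μ : riemannRochSpace D₁ →ₗ[K] LinearMap.ker ev :=
    LinearMap.codRestrict _
      (((LinearMap.mulLeft K W).comp (riemannRochSpace D₁).subtype).codRestrict
        (riemannRochSpace D₂) fun h => hmulmem h h.2)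
      (by
        intro h
        rw [LinearMap.mem_ker]
        ext R
        rw [hev, Pi.zero_apply]
        refine value_eq _ ?_
        rw [map_zero, sub_zero]
        change R.1.valuation (W * (h : F)) < 1
        rw [map_mul]
        refine mul_lt_one_of_lt_of_le (hWZ R R.2) ?_
        have := h.2 R.1
        rwa [hD₁ne R.1 (by intro h'; exact hinfZ (h' ▸ R.2)), exp_zero] at this)
  have hμ : Function.Injective μ := by
    intro f g h
    have h1 : W * (f : F) = W * (g : F) := congrArg (fun x : LinearMap.ker ev => ((x : riemannRochSpace D₂) : F)) h
    exact Subtype.ext (mul_left_cancel₀ hW h1)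
  have := LinearMap.finrank_le_finrank_of_injective hμ
  omega

end Place

/-! ### Places of the Hermitian function field -/

namespace HermitianField

open scoped WithZero
open WithZero Place

variable {K : Type*} [Field K] {q : ℕ} [hq1 : Fact (1 < q)]

theorem monic_hermitianPolynomial : (hermitianPolynomial K q).Monic := by
  rw [hermitianPolynomial, add_sub_assoc]
  refine monic_X_pow_add ((degree_X_sub_C_le _).trans_lt ?_)
  exact_mod_cast hq1.out

theorem curve_eq : y K q ^ q + y K q = x K q ^ (q + 1) := by
  have h := AdjoinRoot.eval₂_root (hermitianPolynomial K q)
  conv_lhs at h => enter [3]; rw [hermitianPolynomial]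
  rw [eval₂_sub, eval₂_add, eval₂_pow, eval₂_X, eval₂_C, map_pow, sub_eq_zero] at h
  exact h

theorem adjoin_x_y : IntermediateField.adjoin K {x K q, y K q} = ⊤ := by
  rw [eq_top_iff]
  intro h _
  have hx : x K q ∈ IntermediateField.adjoin K {x K q, y K q} :=
    IntermediateField.subset_adjoin _ _ (by simp)
  have hy : y K q ∈ IntermediateField.adjoin K {x K q, y K q} :=
    IntermediateField.subset_adjoin _ _ (by simp)
  have hpoly : ∀ p : K[X], AdjoinRoot.of (hermitianPolynomial K q) (algebraMap _ _ p) ∈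
      IntermediateField.adjoin K {x K q, y K q} := by
    intro p
    have : AdjoinRoot.of (hermitianPolynomial K q) (algebraMap _ _ p) = aeval (x K q) p := by
      rw [aeval_def, x]
      have h1 : (algebraMap K[X] (RatFunc K)) p = aeval (RatFunc.X : RatFunc K) p := by
        rw [RatFunc.aeval_X_left_eq_algebraMap]
      rw [h1, aeval_def, hom_eval₂]
      rfl
    rw [this]
    rw [aeval_eq_sum_range]
    exact sum_mem fun i _ => IntermediateField.smul_mem _ (pow_mem hx i)
  have hrat : ∀ f : RatFunc K, AdjoinRoot.of (hermitianPolynomial K q) f ∈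
      IntermediateField.adjoin K {x K q, y K q} := by
    intro f
    rw [← RatFunc.num_div_denom f, map_div₀]
    exact div_mem (hpoly _) (hpoly _)
  induction h using AdjoinRoot.induction_on with
  | ih p =>
    induction p using Polynomial.induction_on' with
    | add f g hf hg => rw [map_add]; exact add_mem (hf trivial) (hg trivial)
    | monomial n a =>
      rw [← C_mul_X_pow_eq_monomial, map_mul, map_pow, AdjoinRoot.mk_X, AdjoinRoot.mk_C]
      exact mul_mem (hrat a) (pow_mem hy n)

theorem sub_pow_of_eq_char_pow {R : Type*} [CommRing R] {p m q : ℕ} [Fact p.Prime] [CharP R p]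
    (hq : q = p ^ m) (a b : R) : (a - b) ^ q = a ^ q - b ^ q := by
  rw [hq, sub_pow_char_pow]

section Infinity

variable {P : Place K (HermitianField K q)}

theorem one_lt_valuation_y (hP : x K q ∉ P.ring) : 1 < P.valuation (y K q) := by
  rw [← valuation_le_one_iff, not_le] at hP
  by_contra! h
  have h1 : P.valuation (x K q ^ (q + 1)) ≤ 1 := by
    rw [← curve_eq]
    exact P.valuation.map_add_le (by rw [map_pow]; exact pow_le_one' h q) h
  rw [map_pow] at h1
  exact absurd h1 (not_le.2 (one_lt_pow₀ hP (by omega)))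

theorem valuation_y_pow (hP : x K q ∉ P.ring) :
    P.valuation (y K q) ^ q = P.valuation (x K q) ^ (q + 1) := by
  have hy := one_lt_valuation_y hP
  rw [← map_pow, ← map_pow, ← curve_eq]
  refine (P.valuation.map_add_eq_of_lt_left ?_).symm
  rw [map_pow]
  exact lt_self_pow₀ hy hq1.out

theorem y_ne_zero_of_pole (hP : x K q ∉ P.ring) : y K q ≠ 0 := by
  intro h
  have := one_lt_valuation_y hP
  simp [h] at this

theorem x_ne_zero_of_pole (hP : x K q ∉ P.ring) : x K q ≠ 0 := by
  intro h
  rw [h] at hP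
  exact hP P.ring.zero_mem

theorem valuation_inv_y_lt (hP : x K q ∉ P.ring) : P.valuation (y K q)⁻¹ < 1 := by
  rw [map_inv₀]
  exact inv_lt_one_of_one_lt₀ (one_lt_valuation_y hP)

theorem valuation_x_div_y_lt (hP : x K q ∉ P.ring) : P.valuation (x K q / y K q) < 1 := by
  have hy := one_lt_valuation_y hP
  rw [map_div₀, div_lt_one₀ (zero_lt_one.trans hy)]
  by_contra! h
  have h1 : P.valuation (y K q) ^ q ≤ P.valuation (x K q) ^ q := pow_le_pow_left' h q
  rw [valuation_y_pow hP] at h1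
  rw [← valuation_le_one_iff, not_le] at hP
  exact absurd h1 (not_le.2 (pow_lt_pow_right₀ hP (by omega)))

theorem adjoin_inv_y (hy : y K q ≠ 0) :
    IntermediateField.adjoin K {(y K q)⁻¹, x K q / y K q} = ⊤ := by
  rw [eq_top_iff, ← adjoin_x_y, IntermediateField.adjoin_le_iff]
  have h1 : (y K q)⁻¹ ∈ IntermediateField.adjoin K {(y K q)⁻¹, x K q / y K q} :=
    IntermediateField.subset_adjoin _ _ (by simp)
  have h2 : x K q / y K q ∈ IntermediateField.adjoin K {(y K q)⁻¹, x K q / y K q} :=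
    IntermediateField.subset_adjoin _ _ (by simp)
  rintro _ (rfl | rfl)
  · have : (x K q / y K q) / (y K q)⁻¹ = x K q := by field_simp
    have h3 := div_mem h2 h1
    rwa [this] at h3
  · have h3 := inv_mem h1
    rwa [inv_inv] at h3

/-- This is the equation of the curve divided by y^(q+1), with s = 1/y and t = x/y: s + s^q =
t^(q+1). It shows smoothness at infinity with local parameter t. -/
theorem inv_y_rel (hy : y K q ≠ 0) :
    (y K q)⁻¹ * (1 + (y K q)⁻¹ * (y K q)⁻¹ ^ (q - 2)) =
      x K q / y K q * (x K q / y K q) ^ q := by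
  have h : (y K q)⁻¹ * (y K q)⁻¹ ^ (q - 2) = (y K q)⁻¹ ^ (q - 1) := by
    rw [← pow_succ']; congr 1; have := hq1.out; omega
  have h' : y K q ^ q = y K q * y K q ^ (q - 1) := by
    rw [← pow_succ']; congr 1; have := hq1.out; omega
  rw [h, ← pow_succ', div_pow, ← curve_eq, inv_pow, pow_succ, h']
  field_simp

theorem mem_adjoin_left {F : Type*} [Field F] [Algebra K F] (s t : F) :
    s ∈ Algebra.adjoin K {s, t} := Algebra.subset_adjoin (by simp)

theorem mem_adjoin_right {F : Type*} [Field F] [Algebra K F] (s t : F) :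
    t ∈ Algebra.adjoin K {s, t} := Algebra.subset_adjoin (by simp)

theorem eq_of_pole {P' : Place K (HermitianField K q)} (hP : x K q ∉ P.ring)
    (hP' : x K q ∉ P'.ring) : P = P' :=
  have hy := y_ne_zero_of_pole hP
  eq_of_vanish (adjoin_inv_y hy) (pow_mem (mem_adjoin_right _ _) q)
    (pow_mem (mem_adjoin_left _ _) (q - 2)) (inv_y_rel hy) P P' (valuation_inv_y_lt hP)
    (valuation_x_div_y_lt hP) (valuation_inv_y_lt hP') (valuation_x_div_y_lt hP')

theorem constResidues_of_pole (hP : x K q ∉ P.ring) : P.ConstResidues :=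
  have hy := y_ne_zero_of_pole hP
  constResidues_of_vanish (adjoin_inv_y hy) (pow_mem (mem_adjoin_right _ _) q)
    (pow_mem (mem_adjoin_left _ _) (q - 2)) (inv_y_rel hy) P (valuation_inv_y_lt hP)
    (valuation_x_div_y_lt hP)

theorem valuation_x_div_y (hP : x K q ∉ P.ring) : P.valuation (x K q / y K q) = exp (-1) :=
  have hy := y_ne_zero_of_pole hP
  valuation_eq_exp_neg_one (adjoin_inv_y hy) (pow_mem (mem_adjoin_right _ _) q)
    (pow_mem (mem_adjoin_left _ _) (q - 2)) (inv_y_rel hy) P (valuation_inv_y_lt hP)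
    (valuation_x_div_y_lt hP)

theorem valuation_x_of_pole (hP : x K q ∉ P.ring) : P.valuation (x K q) = exp (q : ℤ) := by
  have hx0 : P.valuation (x K q) ≠ 0 := by simpa using x_ne_zero_of_pole hP
  have h := congrArg (· ^ q) (valuation_x_div_y hP)
  simp only [map_div₀, div_pow, valuation_y_pow hP] at h
  rw [pow_succ, div_mul_cancel_left₀ (pow_ne_zero _ hx0), ← exp_nsmul, inv_eq_iff_eq_inv] at h
  rw [h, ← exp_neg]
  simp

theorem valuation_y_of_pole (hP : x K q ∉ P.ring) : P.valuation (y K q) = exp (q + 1 : ℤ) := by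
  have hy0 : P.valuation (y K q) ≠ 0 := by simpa using y_ne_zero_of_pole hP
  have h := valuation_x_div_y hP
  rw [map_div₀, valuation_x_of_pole hP, div_eq_iff hy0] at h
  rw [exp_add, h, mul_comm, ← mul_assoc, ← exp_add]
  simp

end Infinity

section Affine

variable {P : Place K (HermitianField K q)}

theorem valuation_y_le_one (hP : x K q ∈ P.ring) : P.valuation (y K q) ≤ 1 := by
  by_contra! h
  have h1 : P.valuation (y K q) < P.valuation (y K q ^ q) := by
    rw [map_pow]; exact lt_self_pow₀ h hq1.out
  have h2 := P.valuation.map_add_eq_of_lt_left h1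
  rw [curve_eq, map_pow, map_pow] at h2
  have h3 : P.valuation (x K q) ^ (q + 1) ≤ 1 := pow_le_one' (P.valuation_le_one_iff.2 hP) _
  rw [h2] at h3
  exact absurd h3 (not_le.2 (one_lt_pow₀ h (by have := hq1.out; omega)))

variable {p m : ℕ} [Fact p.Prime] [CharP K p] (hq : q = p ^ m)
include hq

theorem eq_of_value_eq {P' : Place K (HermitianField K q)} (hx : x K q ∈ P.ring)
    (hx' : x K q ∈ P'.ring) (hP : P.ConstResidues) (hP' : P'.ConstResidues)
    (hxx : P.value (x K q) = P'.value (x K q)) (hyy : P.value (y K q) = P'.value (y K q)) :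
    P = P' := by
  set a := P.value (x K q) with ha
  set b := P.value (y K q) with hb
  have hvx := hP.valuation_sub_value_lt (P.valuation_le_one_iff.2 hx)
  have hvy := hP.valuation_sub_value_lt (valuation_y_le_one hx)
  have hvx' := hP'.valuation_sub_value_lt (P'.valuation_le_one_iff.2 hx')
  have hvy' := hP'.valuation_sub_value_lt (valuation_y_le_one hx')
  rw [← hxx] at hvx'
  rw [← hyy] at hvy'
  rw [← ha] at hvx
  rw [← hb] at hvy
  have hab : b ^ q + b = a ^ (q + 1) := by
    have hvy1 := valuation_y_le_one hx
    have hvx1 := P.valuation_le_one_iff.2 hx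
    rw [ha, hb, ← hP.value_pow hvy1, ← hP.value_pow hvx1, ← curve_eq,
      hP.value_add (by rw [map_pow]; exact pow_le_one' hvy1 q) hvy1]
  set s := y K q - algebraMap K _ b with hs
  set t := x K q - algebraMap K _ a with ht
  have hsm := mem_adjoin_left (K := K) s t
  have htm := mem_adjoin_right (K := K) s t
  have hxm : x K q ∈ Algebra.adjoin K {s, t} := by
    have : x K q = t + algebraMap K _ a := by rw [ht]; ring
    rw [this]
    exact add_mem htm (Subalgebra.algebraMap_mem _ _)
  have hgen : IntermediateField.adjoin K {s, t} = ⊤ := by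
    rw [eq_top_iff, ← adjoin_x_y, IntermediateField.adjoin_le_iff]
    have h1 : s ∈ IntermediateField.adjoin K {s, t} :=
      IntermediateField.subset_adjoin _ _ (by simp)
    have h2 : t ∈ IntermediateField.adjoin K {s, t} :=
      IntermediateField.subset_adjoin _ _ (by simp)
    rintro _ (rfl | rfl)
    · have : x K q = t + algebraMap K _ a := by rw [ht]; ring
      rw [this]
      exact add_mem h2 (algebraMap_mem _ _)
    · have : y K q = s + algebraMap K _ b := by rw [hs]; ring
      rw [this]
      exact add_mem h1 (algebraMap_mem _ _)
  -- As the q-th power is additive, s^q + s = (y^q + y) - (b^q + b) = x^(q+1) - a^(q+1), which is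
  -- divisible by t = x - a.
  have hrel : s * (1 + s * s ^ (q - 2)) =
      t * ∑ i ∈ Finset.range (q + 1), x K q ^ i * algebraMap K _ a ^ (q + 1 - 1 - i) := by
    have : CharP (HermitianField K q) p := charP_of_injective_algebraMap
      (algebraMap K (HermitianField K q)).injective p
    rw [mul_comm t, (Commute.all _ _).geom_sum₂_mul, ← map_pow, ← hab, ← curve_eq, map_add, map_pow]
    have h : s * (1 + s * s ^ (q - 2)) = s ^ q + s := by
      have : s ^ q = s * (s * s ^ (q - 2)) := by
        rw [← pow_succ', ← pow_succ']; congr 1; have := hq1.out; omega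
      rw [this]; ring
    have h' : s ^ q = y K q ^ q - algebraMap K _ b ^ q := by
      rw [hs, sub_pow_of_eq_char_pow hq]
    rw [h, h', hs]; ring
  exact eq_of_vanish hgen
    (sum_mem fun i _ => mul_mem (pow_mem hxm i) (pow_mem (Subalgebra.algebraMap_mem _ _) _))
    (pow_mem hsm (q - 2)) hrel P P' hvy hvx hvy' hvx'

end Affine

end HermitianField

/-! ### Functions regular away from P_∞ -/

namespace HermitianField

open scoped WithZero
open WithZero Place

variable {K : Type*} [Field K] {q : ℕ} [hq1 : Fact (1 < q)]

theorem minpoly_y : minpoly (RatFunc K) (y K q) = hermitianPolynomial K q := by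
  rw [y, AdjoinRoot.minpoly_root monic_hermitianPolynomial.ne_zero,
    monic_hermitianPolynomial.leadingCoeff]
  simp

/-- A unit derivative makes the extension separable and K[x, y] its own dual under the trace form.
-/
theorem derivative_hermitianPolynomial {K : Type*} [Field K] {q : ℕ} (hqK : (q : K) = 0) :
    derivative (hermitianPolynomial K q) = 1 := by
  have : (q : RatFunc K) = 0 := by
    rw [← map_natCast (algebraMap K (RatFunc K)), hqK, map_zero]
  rw [hermitianPolynomial, derivative_sub, derivative_C]
  simp [derivative_X_pow, this]

instance finiteDimensional : FiniteDimensional (RatFunc K) (HermitianField K q) :=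
  monic_hermitianPolynomial.finite_adjoinRoot

theorem isSeparable (hqK : (q : K) = 0) :
    Algebra.IsSeparable (RatFunc K) (HermitianField K q) := by
  have h : IsSeparable (RatFunc K) (y K q) := by
    rw [IsSeparable, minpoly_y, Polynomial.Separable, derivative_hermitianPolynomial hqK]
    exact isCoprime_one_right
  have h1 := (IntermediateField.isSeparable_adjoin_simple_iff_isSeparable _ _).2 h
  rw [y, IntermediateField.adjoin_root_eq_top] at h1
  exact (AlgEquiv.Algebra.isSeparable_iff IntermediateField.topEquiv).1 h1

/-- The equation of the Hermitian curve over `K[x]`. -/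
noncomputable def integralEquation (K : Type*) [Field K] (q : ℕ) : K[X][X] :=
  X ^ q + X - C (X ^ (q + 1))

theorem monic_integralEquation : (integralEquation K q).Monic := by
  rw [integralEquation, add_sub_assoc]
  refine monic_X_pow_add ((degree_X_sub_C_le _).trans_lt ?_)
  exact_mod_cast hq1.out

theorem natDegree_integralEquation : (integralEquation K q).natDegree = q := by
  have h1 : (X - C (X ^ (q + 1)) : K[X][X]).natDegree < q := by
    rw [natDegree_X_sub_C]; exact hq1.out
  rw [integralEquation, add_sub_assoc, natDegree_add_eq_left_of_natDegree_lt] <;>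
    rw [natDegree_X_pow]
  exact h1

theorem algebraMap_eq_aeval (c : K[X]) :
    algebraMap K[X] (HermitianField K q) c = aeval (x K q) c := by
  rw [IsScalarTower.algebraMap_apply K[X] (RatFunc K) (HermitianField K q)]
  rw [← RatFunc.aeval_X_left_eq_algebraMap, aeval_def, hom_eval₂, aeval_def]
  rfl

theorem aeval_y_integralEquation : aeval (y K q) (integralEquation K q) = 0 := by
  simp only [integralEquation, map_sub, map_add, map_pow, aeval_X, aeval_C, algebraMap_eq_aeval]
  rw [sub_eq_zero]
  exact curve_eq

theorem isIntegral_y : IsIntegral K[X] (y K q) :=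
  ⟨integralEquation K q, monic_integralEquation, by
    rw [← aeval_def]; exact aeval_y_integralEquation⟩

/-- Each height-one prime of the integral closure of K[x] defines a place where x is regular, hence
one other than P_∞. A function regular at all these primes lies in the Dedekind domain. -/
theorem isIntegral_of_valuation_le_one (hqK : (q : K) = 0)
    {Pinf : Place K (HermitianField K q)} (hinf : x K q ∉ Pinf.ring) {h : HermitianField K q}
    (hh : ∀ R, R ≠ Pinf → R.valuation h ≤ 1) : IsIntegral K[X] h := by
  have := isSeparable (q := q) hqK
  have : IsDedekindDomain (integralClosure K[X] (HermitianField K q)) :=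
    integralClosure.isDedekindDomain K[X] (RatFunc K) (HermitianField K q)
  have : IsFractionRing (integralClosure K[X] (HermitianField K q)) (HermitianField K q) :=
    integralClosure.isFractionRing_of_finite_extension (RatFunc K) (HermitianField K q)
  obtain ⟨b, rfl⟩ := IsDedekindDomain.HeightOneSpectrum.mem_integers_of_valuation_le_one
    (R := integralClosure K[X] (HermitianField K q)) (HermitianField K q) h (by
      intro v
      have hreg : ∀ c : K[X], v.valuation (HermitianField K q)
          (algebraMap K[X] (HermitianField K q) c) ≤ 1 := fun c =>
        v.valuation_le_one (algebraMap K[X] (integralClosure K[X] (HermitianField K q)) c)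
      let R : Place K (HermitianField K q) :=
        { ring := (v.valuation (HermitianField K q)).valuationSubring
          const_mem := fun a => by
            rw [Valuation.mem_valuationSubring_iff]
            have := hreg (C a)
            rwa [algebraMap_eq_aeval, aeval_C] at this
          isDVR := (v.valuation (HermitianField K q)).valuationSubring_isDiscreteValuationRing }
      have hR : R ≠ Pinf := by
        intro hR
        apply hinf
        rw [← hR, Valuation.mem_valuationSubring_iff]
        have := hreg X
        rwa [algebraMap_eq_aeval, aeval_X] at this
      exact R.valuation_le_one_iff.1 (hh R hR))
  exact b.2

/-- Traces of h against K[x, y] are polynomials, so h lies in the trace dual of K[x, y], which is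
K[x, y] itself. The bound on the degree comes from division by the monic equation. -/
theorem exists_aeval_y (hqK : (q : K) = 0) {h : HermitianField K q} (hh : IsIntegral K[X] h) :
    ∃ f : K[X][X], f.natDegree < q ∧ h = aeval (y K q) f := by
  have := isSeparable (q := q) hqK
  have htop : Algebra.adjoin (RatFunc K) {y K q} = ⊤ := AdjoinRoot.adjoinRoot_eq_top
  have hdual := traceForm_dualSubmodule_adjoin K[X] (RatFunc K) htop isIntegral_y
  rw [minpoly_y, derivative_hermitianPolynomial hqK, map_one, inv_one, one_smul] at hdual
  have hmem : h ∈ (Algebra.traceForm (RatFunc K) (HermitianField K q)).dualSubmodule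
      (Subalgebra.toSubmodule (Algebra.adjoin K[X] {y K q})) := by
    rw [LinearMap.BilinForm.mem_dualSubmodule]
    intro g hg
    have hgi : IsIntegral K[X] g :=
      (adjoin_le_integralClosure isIntegral_y) hg
    rw [Submodule.mem_one, Algebra.traceForm_apply]
    exact IsIntegrallyClosed.isIntegral_iff.1 (Algebra.isIntegral_trace (hh.mul hgi))
  rw [hdual, Subalgebra.mem_toSubmodule, Algebra.adjoin_singleton_eq_range_aeval] at hmem
  obtain ⟨f, rfl⟩ := hmem
  refine ⟨f %ₘ integralEquation K q, ?_, ?_⟩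
  · have := natDegree_modByMonic_lt f monic_integralEquation (q := integralEquation K q) (by
      intro h1
      have := natDegree_integralEquation (K := K) (q := q)
      rw [h1, natDegree_one] at this
      have := hq1.out
      omega)
    rwa [natDegree_integralEquation] at this
  · have := congrArg (aeval (y K q)) (modByMonic_add_div f (integralEquation K q))
    rw [map_add, map_mul, aeval_y_integralEquation, zero_mul, add_zero] at this
    exact this.symm

instance isTrivialOn {F : Type*} [Field F] [Algebra K F] (P : Place K F) :
    P.valuation.IsTrivialOn K := ⟨fun _ ha => P.valuation_algebraMap ha⟩

/-- Write h as a sum of c_i(x) y^i with i < q. The nonzero terms have the pole orders q deg c_i +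
(q+1) i at P_∞, which are pairwise distinct, so the largest is the pole order of h; it is never
negative. -/
theorem eq_zero_of_vanish_at_pole (hqK : (q : K) = 0)
    {Pinf : Place K (HermitianField K q)} (hinf : x K q ∉ Pinf.ring) {h : HermitianField K q}
    (hh : ∀ R, R ≠ Pinf → R.valuation h ≤ 1) (hlt : Pinf.valuation h < 1) : h = 0 := by
  obtain ⟨f, hf, rfl⟩ := exists_aeval_y hqK (isIntegral_of_valuation_le_one hqK hinf hh)
  by_contra hne
  have hf0 : f ≠ 0 := by rintro rfl; simp at hne
  have hx1 : 1 < Pinf.valuation (x K q) := by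
    rw [← not_le, valuation_le_one_iff]; exact hinf
  have hterm : ∀ i ∈ f.support, Pinf.valuation (algebraMap _ _ (f.coeff i) * y K q ^ i) =
      exp (q * (f.coeff i).natDegree + i * (q + 1) : ℤ) := by
    intro i hi
    rw [map_mul, algebraMap_eq_aeval,
      Polynomial.valuation_aeval_eq_valuation_X_pow_natDegree_of_one_lt_valuation_X _ hx1
        (mem_support_iff.1 hi), map_pow, valuation_x_of_pole hinf, valuation_y_of_pole hinf,
      ← exp_nsmul, ← exp_nsmul, ← exp_add]
    congr 1
    simp only [nsmul_eq_mul]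
    ring
  obtain ⟨j, hj, hmax⟩ := f.support.exists_max_image
    (fun i => (q * (f.coeff i).natDegree + i * (q + 1) : ℤ)) (support_nonempty.2 hf0)
  have hv : Pinf.valuation (aeval (y K q) f) =
      exp (q * (f.coeff j).natDegree + j * (q + 1) : ℤ) := by
    rw [aeval_def, eval₂_eq_sum, sum_def, ← hterm j hj]
    refine Valuation.map_sum_eq_of_lt _ hj fun i hi => ?_
    rw [Finset.mem_sdiff, Finset.mem_singleton] at hi
    rw [hterm i hi.1, hterm j hj, exp_lt_exp]
    refine lt_of_le_of_ne (hmax i hi.1) fun heq => hi.2 ?_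
    have hi1 := (le_natDegree_of_mem_supp i hi.1).trans_lt hf
    have hj1 := (le_natDegree_of_mem_supp j hj).trans_lt hf
    -- Modulo q the pole order is i, and the exponents are below q.
    have h1 : (i : ℤ) ≡ j [ZMOD q] := by
      rw [Int.modEq_iff_dvd]
      exact ⟨(f.coeff i).natDegree - (f.coeff j).natDegree + i - j, by linear_combination -heq⟩
    exact Nat.ModEq.eq_of_lt_of_lt (Int.natCast_modEq_iff.1 h1) hi1 hj1
  rw [hv, ← exp_zero, exp_lt_exp] at hlt
  have : (0 : ℤ) ≤ q * (f.coeff j).natDegree + j * (q + 1) := by positivity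
  omega

end HermitianField

/-! ### Action of an automorphism on places, and polynomials in functions -/

namespace Place

open scoped WithZero
open WithZero

variable {K F : Type*} [Field K] [Field F] [Algebra K F]

theorem ext_valuation {P P' : Place K F} (h : ∀ f, P.valuation f = P'.valuation f) : P = P' := by
  apply ring_injective
  ext f
  rw [← valuation_le_one_iff, ← valuation_le_one_iff, h]

theorem valuation_map_zpow (φ : F ≃ₐ[K] F) (P : Place K F) (j : ℤ) (h : F) :
    (P.map (φ ^ j)).valuation h = P.valuation ((φ ^ (-j)) h) := by
  rw [valuation_map, zpow_neg]; rfl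

theorem map_map_zpow (φ : F ≃ₐ[K] F) (P : Place K F) (i j : ℤ) :
    (P.map (φ ^ i)).map (φ ^ j) = P.map (φ ^ (i + j)) := by
  apply ext_valuation
  intro f
  rw [valuation_map_zpow, valuation_map_zpow, valuation_map_zpow, neg_add, zpow_add]
  rfl

theorem map_zpow_zero (φ : F ≃ₐ[K] F) (P : Place K F) : P.map (φ ^ (0 : ℤ)) = P := by
  apply ext_valuation
  intro f
  rw [valuation_map_zpow]
  simp

theorem map_zpow_eq_iff (φ : F ≃ₐ[K] F) (P R : Place K F) (j : ℤ) :
    R.map (φ ^ j) = P ↔ R = P.map (φ ^ (-j)) := by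
  constructor <;> rintro rfl
  · rw [map_map_zpow, add_neg_cancel, map_zpow_zero]
  · rw [map_map_zpow, neg_add_cancel, map_zpow_zero]

theorem ConstResidues.value_map_zpow {P : Place K F} (hP : P.ConstResidues) (φ : F ≃ₐ[K] F)
    (j : ℤ) {h : F} (hh : (P.map (φ ^ j)).valuation h ≤ 1) :
    (P.map (φ ^ j)).value h = P.value ((φ ^ (-j)) h) := by
  apply value_eq
  rw [valuation_map_zpow] at hh
  rw [valuation_map_zpow, map_sub, AlgEquiv.commutes]
  exact hP.valuation_sub_value_lt hh

theorem ConstResidues.aeval_value {P : Place K F} (hP : P.ConstResidues) {σ : Type*} {g : σ → F}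
    (hg : ∀ t, P.valuation (g t) ≤ 1) (f : MvPolynomial σ K) :
    P.valuation (MvPolynomial.aeval g f) ≤ 1 ∧
      P.value (MvPolynomial.aeval g f) = MvPolynomial.eval (fun t => P.value (g t)) f := by
  induction f using MvPolynomial.induction_on with
  | C a =>
    rw [MvPolynomial.aeval_C, MvPolynomial.eval_C]
    exact ⟨P.valuation_algebraMap_le_one a, P.value_algebraMap a⟩
  | add f₁ f₂ h₁ h₂ =>
    rw [map_add (MvPolynomial.aeval g), map_add (MvPolynomial.eval _),
      hP.value_add h₁.1 h₂.1, h₁.2, h₂.2]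
    exact ⟨P.valuation.map_add_le h₁.1 h₂.1, rfl⟩
  | mul_X f₁ t h₁ =>
    rw [map_mul (MvPolynomial.aeval g), map_mul (MvPolynomial.eval _), MvPolynomial.aeval_X,
      MvPolynomial.eval_X, hP.value_mul h₁.1 (hg t), h₁.2, map_mul]
    exact ⟨mul_le_one' h₁.1 (hg t), rfl⟩

/-- Each monomial has exponent at most r in every variable. The pole bounds c are kept separate for
each variable, since at a translate of P only one of the functions has a pole. -/
theorem valuation_aeval_le (P : Place K F) {σ : Type*} [Fintype σ] {g : σ → F} {c : σ → ℕ}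
    (hg : ∀ t, P.valuation (g t) ≤ exp (c t : ℤ)) {f : MvPolynomial σ K} {r : ℕ}
    (hf : ∀ t, MvPolynomial.degreeOf t f ≤ r) :
    P.valuation (MvPolynomial.aeval g f) ≤ exp ((∑ t, r * c t : ℕ) : ℤ) := by
  rw [MvPolynomial.aeval_def, MvPolynomial.eval₂_eq']
  refine P.valuation.map_sum_le fun d hd => ?_
  rw [map_mul, map_prod]
  refine (mul_le_of_le_one_left' (P.valuation_algebraMap_le_one _)).trans ?_
  have hexp : exp ((∑ t, r * c t : ℕ) : ℤ) = ∏ t, exp ((r * c t : ℕ) : ℤ) := by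
    induction (Finset.univ : Finset σ) using Finset.cons_induction with
    | empty => simp
    | cons a s ha ih => rw [Finset.sum_cons, Finset.prod_cons, Nat.cast_add, exp_add, ih]
  rw [hexp]
  refine Finset.prod_le_prod' fun t _ => ?_
  rw [map_pow]
  calc P.valuation (g t) ^ d t ≤ exp (c t : ℤ) ^ d t := pow_le_pow_left' (hg t) _
    _ = exp ((d t * c t : ℕ) : ℤ) := by rw [← exp_nsmul, nsmul_eq_mul]; push_cast; rfl
    _ ≤ exp ((r * c t : ℕ) : ℤ) := by
      rw [exp_le_exp]
      exact_mod_cast Nat.mul_le_mul_right _ ((MvPolynomial.monomial_le_degreeOf t hd).trans (hf t))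

end Place

/-! ### Separation of rational places, and translation by θ -/

namespace HermitianField

open scoped WithZero
open WithZero Place

variable {K : Type*} [Field K] {q : ℕ} [hq1 : Fact (1 < q)]

theorem x_mem_of_ne {Pinf R : Place K (HermitianField K q)} (hinf : x K q ∉ Pinf.ring)
    (hR : R ≠ Pinf) : x K q ∈ R.ring := by
  by_contra h
  exact hR (eq_of_pole h hinf)

section Separation

variable {p m : ℕ} [Fact p.Prime] [CharP K p] (hq : q = p ^ m)
include hq

/-- The functions regular away from `P_∞` separate the rational places. -/
theorem exists_separating_pair {Pinf R R' : Place K (HermitianField K q)}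
    (hinf : x K q ∉ Pinf.ring) (hR : R.ConstResidues) (hR' : R'.ConstResidues) (hRinf : R ≠ Pinf)
    (hRinf' : R' ≠ Pinf) (hne : R' ≠ R) :
    ∃ e : HermitianField K q, (∀ R₁, R₁ ≠ Pinf → R₁.valuation e ≤ 1) ∧
      R.valuation (e - 1) < 1 ∧ R'.valuation e < 1 := by
  have main : ∀ g : HermitianField K q, (∀ R₁, R₁ ≠ Pinf → R₁.valuation g ≤ 1) →
      R.value g ≠ R'.value g → ∃ e : HermitianField K q, (∀ R₁, R₁ ≠ Pinf → R₁.valuation e ≤ 1) ∧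
      R.valuation (e - 1) < 1 ∧ R'.valuation e < 1 := by
    intro g hg hgne
    have hc : R.value g - R'.value g ≠ 0 := sub_ne_zero.2 hgne
    set c := R.value g - R'.value g with hcdef
    refine ⟨c⁻¹ • (g - algebraMap K _ (R'.value g)), fun R₁ h₁ => ?_, ?_, ?_⟩
    · exact (R₁.valuation_smul_le _ _).trans
        (R₁.valuation.map_sub_le (hg R₁ h₁) (R₁.valuation_algebraMap_le_one _))
    · have : c⁻¹ • (g - algebraMap K _ (R'.value g)) - 1 =
          c⁻¹ • (g - algebraMap K _ (R.value g)) := by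
        have hc' : algebraMap K (HermitianField K q) c ≠ 0 := by simpa using hc
        have h2 : algebraMap K (HermitianField K q) c =
          algebraMap K _ (R.value g) - algebraMap K _ (R'.value g) := by rw [hcdef, map_sub]
        rw [Algebra.smul_def, Algebra.smul_def, map_inv₀]
        field_simp
        rw [h2]; ring
      rw [this]
      exact (R.valuation_smul_le _ _).trans_lt (hR.valuation_sub_value_lt (hg R hRinf))
    · exact (R'.valuation_smul_le _ _).trans_lt (hR'.valuation_sub_value_lt (hg R' hRinf'))
  -- Distinct rational places differ in the value of x or of y, and both functions are regular off
  -- P_∞.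
  by_cases hx : R.value (x K q) = R'.value (x K q)
  · refine main (y K q) (fun R₁ h₁ => valuation_y_le_one (x_mem_of_ne hinf h₁)) fun hy => hne ?_
    exact (eq_of_value_eq hq (x_mem_of_ne hinf hRinf) (x_mem_of_ne hinf hRinf') hR hR' hx hy).symm
  · exact main (x K q) (fun R₁ h₁ => R₁.valuation_le_one_iff.2 (x_mem_of_ne hinf h₁)) hx

/-- The product of the functions that separate R from the single places of Z. -/
theorem exists_separating {Pinf R : Place K (HermitianField K q)}
    (hinf : x K q ∉ Pinf.ring) (hR : R.ConstResidues) (hRinf : R ≠ Pinf)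
    (Z : Finset (Place K (HermitianField K q))) (hZ : ∀ R' ∈ Z, R'.ConstResidues)
    (hZinf : Pinf ∉ Z) : ∃ e : HermitianField K q, (∀ R', R' ≠ Pinf → R'.valuation e ≤ 1) ∧
      R.valuation (e - 1) < 1 ∧ ∀ R' ∈ Z, R' ≠ R → R'.valuation e < 1 := by
  classical
  induction Z using Finset.induction_on with
  | empty => exact ⟨1, fun R' _ => by simp, by simp, by simp⟩
  | insert R' Z _ ih =>
    obtain ⟨e, h1, h2, h3⟩ := ih (fun R₁ h₁ => hZ R₁ (Finset.mem_insert_of_mem h₁))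
      (fun h => hZinf (Finset.mem_insert_of_mem h))
    by_cases hne : R' = R
    · refine ⟨e, h1, h2, fun R₁ h₁ hn => ?_⟩
      rcases Finset.mem_insert.1 h₁ with rfl | h₁
      · exact absurd hne hn
      · exact h3 R₁ h₁ hn
    have hRinf' : R' ≠ Pinf := by rintro rfl; exact hZinf (Finset.mem_insert_self _ _)
    obtain ⟨g, g1, g2, g3⟩ := exists_separating_pair hq hinf hR
      (hZ R' (Finset.mem_insert_self _ _)) hRinf hRinf' hne
    refine ⟨g * e, fun R₁ h₁ => ?_, ?_, fun R₁ h₁ hn => ?_⟩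
    · rw [map_mul]; exact mul_le_one' (g1 R₁ h₁) (h1 R₁ h₁)
    · have : g * e - 1 = (g - 1) * e + (e - 1) := by ring
      rw [this]
      refine R.valuation.map_add_lt ?_ h2
      rw [map_mul]
      exact mul_lt_one_of_lt_of_le g2 (h1 R hRinf)
    · rw [map_mul]
      rcases Finset.mem_insert.1 h₁ with rfl | h₁
      · exact mul_lt_one_of_lt_of_le g3 (h1 _ hRinf')
      · rw [mul_comm]
        have : R₁ ≠ Pinf := by
          rintro rfl; exact hZinf (Finset.mem_insert_of_mem h₁)
        exact mul_lt_one_of_lt_of_le (h3 R₁ h₁ hn) (g1 _ this)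

/-- A nonzero function of the Hermitian function field has at most as many rational zeros as
poles. -/
theorem card_zeros_le {Pinf : Place K (HermitianField K q)} (hinf : x K q ∉ Pinf.ring)
    (Z : Finset (Place K (HermitianField K q))) (hZ : ∀ R ∈ Z, R.ConstResidues) (hinfZ : Pinf ∉ Z)
    (E : Multiset (Place K (HermitianField K q))) (hE : ∀ R ∈ E, R.ConstResidues)
    (hZE : ∀ R ∈ Z, R ∉ E) {W : HermitianField K q} (hW : W ≠ 0)
    (hWE : ∀ R, R.valuation W ≤ 1 ∨ ∃ n : ℕ, R.valuation W ≤ exp (n : ℤ) ∧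
      Multiset.replicate n R ≤ E)
    (hWZ : ∀ R ∈ Z, R.valuation W < 1) : Z.card ≤ E.card := by
  have hqK : (q : K) = 0 := by
    have hm : m ≠ 0 := by
      rintro rfl
      exact hq1.out.ne' (by rw [hq, pow_zero])
    rw [hq, Nat.cast_pow, CharP.cast_eq_zero, zero_pow hm]
  refine Place.card_zeros_le (constResidues_of_pole hinf)
    (fun h => eq_zero_of_vanish_at_pole hqK hinf) Z hZ hinfZ (fun R hR => ?_) E hE hZE hW hWE hWZ
  exact exists_separating hq hinf (hZ R hR) (by rintro rfl; exact hinfZ hR) Z hZ hinfZ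

end Separation

section Translation

variable {φ : HermitianField K q ≃ₐ[K] HermitianField K q} {θ : K}
  (hφx : φ (x K q) = x K q)

include hφx in
theorem zpow_x (j : ℤ) : (φ ^ j) (x K q) = x K q := by
  have hinv : φ⁻¹ (x K q) = x K q := by
    apply φ.injective
    rw [hφx]
    exact φ.apply_symm_apply _
  induction j using Int.induction_on with
  | zero => simp
  | succ i ih => rw [zpow_add_one, AlgEquiv.mul_apply, hφx, ih]
  | pred i ih => rw [zpow_sub_one, AlgEquiv.mul_apply, hinv, ih]

variable (hφy : φ (y K q) = y K q + algebraMap K _ θ)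

include hφy in
theorem zpow_y (j : ℤ) : (φ ^ j) (y K q) = y K q + algebraMap K _ (j * θ) := by
  have hinv : φ⁻¹ (y K q) = y K q - algebraMap K _ θ := by
    apply φ.injective
    rw [map_sub, AlgEquiv.commutes, hφy, add_sub_cancel_right]
    exact φ.apply_symm_apply _
  induction j using Int.induction_on with
  | zero => simp
  | succ i ih =>
    rw [zpow_add_one, AlgEquiv.mul_apply, hφy, map_add, ih, AlgEquiv.commutes, add_assoc,
      ← map_add]
    congr 2; push_cast; ring
  | pred i ih =>
    rw [zpow_sub_one, AlgEquiv.mul_apply, hinv, map_sub, ih, AlgEquiv.commutes, add_sub_assoc,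
      ← map_sub]
    congr 2; push_cast; ring

include hφx in
-- φ fixes x, and x has only one pole.
theorem map_zpow_pole {Pinf : Place K (HermitianField K q)} (hinf : x K q ∉ Pinf.ring) (j : ℤ) :
    Pinf.map (φ ^ j) = Pinf := by
  refine eq_of_pole ?_ hinf
  rwa [← valuation_le_one_iff, valuation_map_zpow, zpow_x hφx, valuation_le_one_iff]

include hφx in
theorem map_zpow_ne_pole {Pinf R : Place K (HermitianField K q)} (hinf : x K q ∉ Pinf.ring)
    (hR : R ≠ Pinf) (j : ℤ) : R.map (φ ^ j) ≠ Pinf := by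
  rw [Ne, map_zpow_eq_iff, map_zpow_pole hφx hinf]
  exact hR

include hφy in
-- The value of y at φ^i(R) is y(R) - iθ, so equal images force (i - j)θ = 0 in characteristic p.
theorem dvd_sub_of_map_zpow_eq {p : ℕ} [CharP K p] (hθ : θ ≠ 0) {R : Place K (HermitianField K q)}
    (hR : R.ConstResidues) (hx : x K q ∈ R.ring) {i j : ℤ}
    (h : R.map (φ ^ i) = R.map (φ ^ j)) : (p : ℤ) ∣ i - j := by
  have hval := hR.valuation_sub_value_lt (valuation_y_le_one hx)
  have key : ∀ i : ℤ, (R.map (φ ^ i)).valuation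
      (y K q - algebraMap K _ (R.value (y K q) - i * θ)) < 1 := by
    intro i
    rw [valuation_map_zpow, map_sub, AlgEquiv.commutes, zpow_y hφy]
    convert hval using 2
    rw [map_sub, Int.cast_neg, neg_mul, map_neg]
    ring
  have h1 := key i
  rw [h] at h1
  have h2 := Place.residue_unique _ h1 (key j)
  have h3 : ((i - j : ℤ) : K) * θ = 0 := by push_cast; linear_combination -h2
  rw [mul_eq_zero, or_iff_left hθ] at h3
  exact (CharP.intCast_eq_zero_iff K p _).1 h3

end Translation

end HermitianField

/-! ### Zeros of z and of the function attached to a recursion -/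

theorem jointNonlinearComplexity_cases {K ι : Type*} [Field K] {n : ℕ} (r : ℕ) {S : ι → Fin n → K}
    (hS : S ≠ 0) : jointNonlinearComplexity r S = n ∨
      1 ≤ jointNonlinearComplexity r S ∧ jointNonlinearComplexity r S < n ∧
        IsGeneratedWithOrder r S (jointNonlinearComplexity r S) := by
  classical
  have h0 : ¬∀ i j, S i j = 0 := fun h => hS (by ext i j; exact h i j)
  rw [jointNonlinearComplexity, if_neg h0]
  split_ifs with h
  · exact Or.inr (Nat.find_spec h)
  · exact Or.inl rfl

namespace HermitianField

open scoped WithZero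
open WithZero Place

variable {K : Type*} [Field K] {q : ℕ} [hq1 : Fact (1 < q)] {p m : ℕ} [hp : Fact p.Prime]
  [CharP K p] (hq : q = p ^ m) {Pinf : Place K (HermitianField K q)} (hinf : x K q ∉ Pinf.ring)
  {P : Place K (HermitianField K q)} (hP : P.ConstResidues) (hPinf : P ≠ Pinf)
  {z : HermitianField K q} {k : ℕ} (hzinf : Pinf.valuation z ≤ exp (k : ℤ))
  (hzP : P.valuation z = exp 1) (hzreg : ∀ R, R ≠ Pinf → R ≠ P → R.valuation z ≤ 1)

include hq hinf hP hzinf hzP hzreg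

/-- A function with pole divisor `k P_∞ + P` has at most `k + 1` rational zeros. -/
theorem card_le_of_value_eq_zero (Z : Finset (Place K (HermitianField K q)))
    (hZ : ∀ R ∈ Z, R.ConstResidues) (hinfZ : Pinf ∉ Z) (hPZ : P ∉ Z)
    (hval : ∀ R ∈ Z, R.value z = 0) : Z.card ≤ k + 1 := by
  have hz0 : z ≠ 0 := by
    rintro rfl
    exact exp_ne_zero (hzP.symm.trans (map_zero _))
  have h := card_zeros_le hq hinf Z hZ hinfZ (Multiset.replicate k Pinf + {P}) (by
      intro R hR
      rcases Multiset.mem_add.1 hR with hR | hR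
      · rw [Multiset.eq_of_mem_replicate hR]; exact constResidues_of_pole hinf
      · rwa [Multiset.mem_singleton.1 hR]) (by
      intro R hR h
      rcases Multiset.mem_add.1 h with h | h
      · exact hinfZ (Multiset.eq_of_mem_replicate h ▸ hR)
      · exact hPZ (Multiset.mem_singleton.1 h ▸ hR)) hz0 (by
      intro R
      by_cases h1 : R = Pinf
      · subst h1
        exact Or.inr ⟨k, hzinf, Multiset.le_add_right _ _⟩
      by_cases h2 : R = P
      · subst h2
        exact Or.inr ⟨1, hzP.le, Multiset.le_add_left _ _⟩
      exact Or.inl (hzreg R h1 h2)) (by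
      intro R hR
      refine ((hZ R hR).value_eq_zero_iff (hzreg R ?_ ?_)).1 (hval R hR)
      · rintro rfl; exact hinfZ hR
      · rintro rfl; exact hPZ hR)
  simpa using h

variable {φ : HermitianField K q ≃ₐ[K] HermitianField K q} {θ : K} (hφx : φ (x K q) = x K q)
  (hφy : φ (y K q) = y K q + algebraMap K _ θ) (hθ : θ ≠ 0)

include hPinf hφx hφy hθ

/-- A polynomial relation between the values of `z` at `u + 1` consecutive translates of rational
places outside the orbit of `P` holds at few places. -/
theorem card_le_of_value_eq_eval {u r : ℕ} (hu : 0 < u) (hup : u < p) (hr : 1 ≤ r)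
    {f : MvPolynomial (Fin u) K} (hf : ∀ t, MvPolynomial.degreeOf t f ≤ r)
    (Z : Finset (Place K (HermitianField K q))) (hZ : ∀ R ∈ Z, R.ConstResidues) (hinfZ : Pinf ∉ Z)
    (hPZ : ∀ R ∈ Z, ∀ j : ℤ, R.map (φ ^ j) ≠ P)
    (hval : ∀ R ∈ Z, (R.map (φ ^ (u : ℤ))).value z =
      MvPolynomial.eval (fun t : Fin u => (R.map (φ ^ ((t : ℕ) : ℤ))).value z) f) :
    Z.card ≤ k * r * u + r * u + 1 := by
  set g : ℕ → HermitianField K q := fun t => (φ ^ (-(t : ℤ))) z with hg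
  have hgval : ∀ (R : Place K (HermitianField K q)) (t : ℕ),
      R.valuation (g t) = (R.map (φ ^ (t : ℤ))).valuation z := fun R t => by
    rw [valuation_map_zpow]
  have hginf : ∀ t, Pinf.valuation (g t) ≤ exp (k : ℤ) := fun t => by
    rw [hgval, map_zpow_pole hφx hinf]; exact hzinf
  have hgreg : ∀ R : Place K (HermitianField K q), R ≠ Pinf → ∀ t : ℕ, R.map (φ ^ (t : ℤ)) ≠ P → R.valuation (g t) ≤ 1 := by
    intro R hR t ht
    rw [hgval]
    exact hzreg _ (map_zpow_ne_pole hφx hinf hR _) ht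
  have hgpole : ∀ (R : Place K (HermitianField K q)) (t : ℕ), R.map (φ ^ (t : ℤ)) = P → R.valuation (g t) = exp 1 := by
    intro R t ht
    rw [hgval, ht, hzP]
  -- At any given place other than P_∞, at most one of the functions g 0, …, g u has a pole, because
  -- u < p.
  have huniq : ∀ (R : Place K (HermitianField K q)) (t t' : ℕ), t < p → t' < p → R.map (φ ^ (t : ℤ)) = P →
      R.map (φ ^ (t' : ℤ)) = P → t = t' := by
    intro R t t' ht ht' h h'
    rw [map_zpow_eq_iff] at h h'
    have h1 := dvd_sub_of_map_zpow_eq hφy (p := p) hθ hP (x_mem_of_ne hinf hPinf) (h.symm.trans h')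
    have h2 : -(t : ℤ) - -(t' : ℤ) = 0 := Int.eq_zero_of_abs_lt_dvd h1 (by rw [abs_lt]; omega)
    omega
  set G := MvPolynomial.aeval (fun t : Fin u => g t) f with hG
  have hGreg : ∀ R : Place K (HermitianField K q), (∀ t : Fin u, R.valuation (g t) ≤ 1) → R.valuation G ≤ 1 := by
    intro R hR
    have := R.valuation_aeval_le (c := fun _ => 0) (by simpa using hR) hf
    simpa using this
  set W := g u - G with hW
  -- The bound for the poles of W: f contributes kru at P_∞ and r at each φ^{-t}(P) with t < u, and
  -- g u contributes the simple pole at φ^{-u}(P).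
  set E : Multiset (Place K (HermitianField K q)) := Multiset.replicate (k * r * u) Pinf +
    ∑ t ∈ Finset.range u, Multiset.replicate r (P.map (φ ^ (-(t : ℤ)))) +
      {P.map (φ ^ (-(u : ℤ)))} with hE
  have hcard : E.card = k * r * u + r * u + 1 := by
    simp [hE, mul_comm]
  have hmemE : ∀ R ∈ E, R = Pinf ∨ ∃ j : ℤ, R = P.map (φ ^ j) := by
    intro R hR
    rcases Multiset.mem_add.1 hR with hR | hR
    · rcases Multiset.mem_add.1 hR with hR | hR
      · exact Or.inl (Multiset.eq_of_mem_replicate hR)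
      · obtain ⟨t, -, ht⟩ := Multiset.mem_sum.1 hR
        exact Or.inr ⟨_, Multiset.eq_of_mem_replicate ht⟩
    · exact Or.inr ⟨_, Multiset.mem_singleton.1 hR⟩
  have hWu : ∀ R : Place K (HermitianField K q), R.map (φ ^ (u : ℤ)) = P → R.valuation W = exp 1 := by
    intro R hR
    have hRinf : R ≠ Pinf := by
      rintro rfl
      rw [map_zpow_pole hφx hinf] at hR
      exact hPinf hR.symm
    have hG1 : R.valuation G ≤ 1 := hGreg R fun t => hgreg R hRinf t fun h => by
      have := huniq R u t hup (t.2.trans hup) hR h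
      have := t.2
      omega
    have h1 : R.valuation G < R.valuation (g u) := by
      rw [hgpole R u hR]
      refine hG1.trans_lt ?_
      rw [← exp_zero, exp_lt_exp]
      norm_num
    rw [hW, R.valuation.map_sub_eq_of_lt_left h1, hgpole R u hR]
  -- The pole of g u at φ^{-u}(P) cannot be cancelled by G, which is regular there.
  have hW0 : W ≠ 0 := by
    intro h
    have := hWu (P.map (φ ^ (-(u : ℤ)))) ((map_zpow_eq_iff φ _ _ _).2 rfl)
    rw [h, map_zero] at this
    exact exp_ne_zero this.symm
  rw [← hcard]
  refine card_zeros_le hq hinf Z hZ hinfZ E ?_ ?_ hW0 ?_ ?_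
  · intro R hR
    rcases hmemE R hR with rfl | ⟨j, rfl⟩
    · exact constResidues_of_pole hinf
    · exact hP.map _
  · intro R hR hRE
    rcases hmemE R hRE with rfl | ⟨j, rfl⟩
    · exact hinfZ hR
    · refine hPZ _ hR (-j) ?_
      rw [map_map_zpow, add_neg_cancel, map_zpow_zero]
  · intro R
    by_cases hRinf : R = Pinf
    · subst hRinf
      -- The pole of g u at P_∞ needs no extra room: k ≤ kru because r and u are positive.
      refine Or.inr ⟨k * r * u, R.valuation.map_sub_le ((hginf u).trans ?_) ?_, ?_⟩
      · rw [exp_le_exp]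
        have : k * 1 ≤ k * (r * u) := Nat.mul_le_mul_left _ (Nat.mul_pos hr hu)
        rw [mul_assoc]
        exact_mod_cast (mul_one k) ▸ this
      · refine (R.valuation_aeval_le (c := fun _ => k) (fun t : Fin u => hginf t) hf).trans (le_of_eq ?_)
        congr 2
        simp only [Finset.sum_const, Finset.card_univ, Fintype.card_fin, smul_eq_mul]
        ring
      · rw [hE, add_assoc]; exact Multiset.le_add_right _ _
    by_cases hRu : R.map (φ ^ (u : ℤ)) = P
    · refine Or.inr ⟨1, (hWu R hRu).le, ?_⟩
      rw [(map_zpow_eq_iff φ _ _ _).1 hRu]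
      exact Multiset.le_add_left _ _
    have hgu : R.valuation (g u) ≤ 1 := hgreg R hRinf u hRu
    by_cases hRt : ∃ t : Fin u, R.map (φ ^ ((t : ℕ) : ℤ)) = P
    · obtain ⟨t, ht⟩ := hRt
      refine Or.inr ⟨r, R.valuation.map_sub_le (hgu.trans ?_) ?_, ?_⟩
      · rw [← exp_zero, exp_le_exp]; positivity
      -- Only g t has a pole here, a simple one, and it enters f to degree at most r.
      · refine (R.valuation_aeval_le (c := fun t' => if t' = t then 1 else 0) ?_ hf).trans
          (le_of_eq ?_)
        · intro t'
          split_ifs with h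
          · subst h
            exact (hgpole R _ ht).le
          · have : R.valuation (g t') ≤ 1 := hgreg R hRinf t' fun h' => h (Fin.ext
              (huniq R t' t (t'.2.trans hup) (t.2.trans hup) h' ht))
            simpa using this
        · simp
      · rw [(map_zpow_eq_iff φ _ _ _).1 ht]
        refine le_trans ?_ (Multiset.le_add_right _ _)
        refine le_trans ?_ (Multiset.le_add_left _ _)
        exact Finset.single_le_sum (f := fun t : ℕ => Multiset.replicate r (P.map (φ ^ (-(t : ℤ)))))
          (fun _ _ => Multiset.zero_le _) (Finset.mem_range.2 t.2)
    · left
      push Not at hRt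
      exact R.valuation.map_sub_le hgu (hGreg R fun t => hgreg R hRinf t (hRt t))
  · intro R hR
    have hRinf : R ≠ Pinf := by rintro rfl; exact hinfZ hR
    have hC := hZ R hR
    have hreg : ∀ t : ℕ, R.valuation (g t) ≤ 1 := fun t => hgreg R hRinf t (hPZ R hR _)
    have hvg : ∀ t : ℕ, (R.map (φ ^ (t : ℤ))).value z = R.value (g t) := fun t =>
      hC.value_map_zpow φ t (by rw [← hgval]; exact hreg t)
    have hGv := hC.aeval_value (fun t : Fin u => hreg t) f
    have h := hval R hR
    rw [hvg] at h
    simp only [hvg] at h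
    rw [← hGv.2] at h
    have h1 := hC.valuation_sub_value_lt (hreg u)
    have h2 := hC.valuation_sub_value_lt hGv.1
    rw [h] at h1
    have h3 := R.valuation.map_sub_lt h1 h2
    rwa [sub_sub_sub_cancel_right] at h3

end HermitianField

/-! ### The places behind the terms of the multisequence -/

/-- The place at which the term of index `t` of the `i`-th sequence is evaluated. -/
noncomputable def orbitPlace {K F : Type*} [Field K] [Field F] [Algebra K F]
    {N M : ℕ} (p : ℕ) (φ : F ≃ₐ[K] F) (Q : Fin N → Fin M → Place K F) (i : Fin N)
    (t : Fin (M * p)) : Place K F :=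
  (Q i t.divNat).map (φ ^ ((t.modNat : ℕ) : ℤ))

theorem orbitMultisequence_eq {K F : Type*} [Field K] [Field F] [Algebra K F]
    {N M : ℕ} (p : ℕ) (φ : F ≃ₐ[K] F) (Q : Fin N → Fin M → Place K F) (z : F) (i : Fin N)
    (t : Fin (M * p)) : orbitMultisequence p φ Q z i t = (orbitPlace p φ Q i t).value z := by
  rw [orbitMultisequence, orbitPlace, zpow_natCast]

/-- A shift by v that does not leave the block of p terms is the action of φ^v. -/
theorem orbitPlace_add {K F : Type*} [Field K] [Field F] [Algebra K F]
    {N M : ℕ} {p : ℕ} (φ : F ≃ₐ[K] F) (Q : Fin N → Fin M → Place K F) (i : Fin N)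
    {t v : ℕ} (htv : t + v < M * p) (hv : t % p + v < p) :
    orbitPlace p φ Q i ⟨t + v, htv⟩ =
      (orbitPlace p φ Q i ⟨t, by omega⟩).map (φ ^ (v : ℤ)) := by
  have hp : 0 < p := by omega
  have h1 : (t + v) / p = t / p := by
    conv_lhs => rw [← Nat.div_add_mod t p, add_assoc, Nat.mul_add_div hp, Nat.div_eq_of_lt hv]
    rfl
  have h2 : (t + v) % p = t % p + v := by
    conv_lhs => rw [← Nat.div_add_mod t p, add_assoc, Nat.mul_add_mod, Nat.mod_eq_of_lt hv]
  have h3 : (⟨t + v, htv⟩ : Fin (M * p)).divNat = (⟨t, by omega⟩ : Fin (M * p)).divNat :=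
    Fin.ext h1
  rw [orbitPlace, orbitPlace, Place.map_map_zpow, h3, Fin.coe_modNat, Fin.coe_modNat, h2]
  push_cast
  rfl

section Labels

variable {K F : Type*} [Field K] [Field F] [Algebra K F] {N M : ℕ} {φ : F ≃ₐ[K] F}
  {Pinf P : Place K F} {Q : Fin N → Fin M → Place K F} (h : LabelsOrbits φ Pinf P Q)
include h

theorem LabelsOrbits.isRational : P.IsRational := (h.1 none).1

theorem LabelsOrbits.ne_pole : P ≠ Pinf := (h.1 none).2

theorem LabelsOrbits.isRational_apply (i : Fin N) (l : Fin M) : (Q i l).IsRational :=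
  (h.1 (some (i, l))).1

theorem LabelsOrbits.apply_ne_pole (i : Fin N) (l : Fin M) : Q i l ≠ Pinf :=
  (h.1 (some (i, l))).2

theorem LabelsOrbits.eq_of_map_eq {i i' : Fin N} {l l' : Fin M} {j j' : ℤ}
    (he : (Q i l).map (φ ^ j) = (Q i' l').map (φ ^ j')) : i = i' ∧ l = l' := by
  rw [Place.map_zpow_eq_iff, Place.map_map_zpow] at he
  obtain ⟨o, -, ho⟩ := h.2 (Q i l) (h.isRational_apply i l) (h.apply_ne_pole i l)
  have h1 := ho (some (i, l)) ⟨0, (Place.map_zpow_zero _ _).symm⟩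
  have h2 := ho (some (i', l')) ⟨_, he⟩
  simpa using h1.trans h2.symm

theorem LabelsOrbits.map_apply_ne (i : Fin N) (l : Fin M) (j : ℤ) : (Q i l).map (φ ^ j) ≠ P := by
  intro he
  rw [Place.map_zpow_eq_iff] at he
  obtain ⟨o, -, ho⟩ := h.2 (Q i l) (h.isRational_apply i l) (h.apply_ne_pole i l)
  have h1 := ho (some (i, l)) ⟨0, (Place.map_zpow_zero _ _).symm⟩
  have h2 := ho none ⟨_, he⟩
  simpa using h1.trans h2.symm

theorem LabelsOrbits.constResidues_orbitPlace {p : ℕ} (i : Fin N) (t : Fin (M * p)) :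
    (orbitPlace p φ Q i t).ConstResidues :=
  (h.isRational_apply _ _).constResidues.map _

theorem LabelsOrbits.map_orbitPlace_ne {p : ℕ} (i : Fin N) (t : Fin (M * p)) (j : ℤ) :
    (orbitPlace p φ Q i t).map (φ ^ j) ≠ P := by
  rw [orbitPlace, Place.map_map_zpow]
  exact h.map_apply_ne _ _ _

end Labels

namespace HermitianField

open scoped WithZero
open WithZero Place

variable {K : Type*} [Field K] {q : ℕ} [hq1 : Fact (1 < q)] {p : ℕ}
  {Pinf : Place K (HermitianField K q)} (hinf : x K q ∉ Pinf.ring)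
  {P : Place K (HermitianField K q)} {N M : ℕ}
  {φ : HermitianField K q ≃ₐ[K] HermitianField K q} {θ : K}
  {Q : Fin N → Fin M → Place K (HermitianField K q)} (hPQ : LabelsOrbits φ Pinf P Q)

include hinf hPQ in
theorem orbitPlace_ne_pole (hφx : φ (x K q) = x K q) (i : Fin N) (t : Fin (M * p)) :
    orbitPlace p φ Q i t ≠ Pinf :=
  map_zpow_ne_pole hφx hinf (hPQ.apply_ne_pole _ _) _

include hinf hPQ in
-- Disjointness of the labelled orbits recovers the sequence and the block; inside a block the
-- exponents of φ are distinct modulo p.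
theorem orbitPlace_injective [CharP K p] (hθ : θ ≠ 0)
    (hφy : φ (y K q) = y K q + algebraMap K _ θ) :
    Function.Injective (fun it : Fin N × Fin (M * p) => orbitPlace p φ Q it.1 it.2) := by
  rintro ⟨i, t⟩ ⟨i', t'⟩ he
  simp only [orbitPlace] at he
  obtain ⟨rfl, hl⟩ := hPQ.eq_of_map_eq he
  rw [hl] at he
  have hd := dvd_sub_of_map_zpow_eq hφy (p := p) hθ
    (hPQ.isRational_apply _ _).constResidues (x_mem_of_ne hinf (hPQ.apply_ne_pole _ _)) he
  have hm1 := t.modNat.2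
  have hm2 := t'.modNat.2
  have h0 := Int.eq_zero_of_abs_lt_dvd hd (by rw [abs_lt]; omega)
  have hdiv : (t : ℕ) / p = t' / p := congrArg Fin.val hl
  have hmod : (t : ℕ) % p = t' % p := by
    have : ((t.modNat : ℕ) : ℤ) = (t'.modNat : ℕ) := by omega
    exact_mod_cast this
  have : (t : ℕ) = t' := by rw [← Nat.div_add_mod (t : ℕ) p, hdiv, hmod, Nat.div_add_mod]
  exact Prod.ext rfl (Fin.ext this)

theorem valuation_le_of_poleDivisor {z : HermitianField K q} {k : ℕ} (hPinf : P ≠ Pinf)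
    (hz : Place.poleDivisor z = k • (Set.indicator {Pinf} 1 : Place K (HermitianField K q) → ℤ)
      + Set.indicator {P} 1) :
    Pinf.valuation z ≤ exp (k : ℤ) ∧ P.valuation z = exp 1 ∧
      ∀ R, R ≠ Pinf → R ≠ P → R.valuation z ≤ 1 := by
  have hmax : ∀ R : Place K (HermitianField K q), max 0 (log (R.valuation z)) =
      k • (Set.indicator {Pinf} 1 : Place K (HermitianField K q) → ℤ) R
        + Set.indicator {P} 1 R := by
    intro R
    have := congrFun hz R
    simpa [poleDivisor, ord] using this
  have hP := hmax P
  have hI := hmax Pinf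
  simp only [Set.indicator, Set.mem_singleton_iff, hPinf, hPinf.symm, if_true, if_false,
    Pi.one_apply, smul_zero, zero_add, add_zero, nsmul_eq_mul, mul_one] at hP hI
  -- The junk order 0 of the zero function contradicts the pole prescribed at P.
  have hz0 : z ≠ 0 := by
    rintro rfl
    simp at hP
  have hv : ∀ R : Place K (HermitianField K q), R.valuation z = exp (log (R.valuation z)) :=
    fun R => (exp_log (by simpa using hz0)).symm
  refine ⟨?_, ?_, fun R h1 h2 => ?_⟩
  · rw [hv, exp_le_exp]; omega
  · rw [hv, exp_inj]; omega
  · have hR := hmax R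
    simp only [Set.indicator, Set.mem_singleton_iff, h1, h2, if_false, smul_zero, add_zero] at hR
    rw [hv, ← exp_zero, exp_le_exp]; omega

end HermitianField

/-! ### Counting terms, and the bounds -/

namespace HermitianField

open scoped WithZero
open WithZero Place

variable {K : Type*} [Field K] {q : ℕ} [hq1 : Fact (1 < q)] {p m : ℕ} [hp : Fact p.Prime]
  [CharP K p] (hq : q = p ^ m) {Pinf : Place K (HermitianField K q)} (hinf : x K q ∉ Pinf.ring)
  {P : Place K (HermitianField K q)} {N M : ℕ}
  {φ : HermitianField K q ≃ₐ[K] HermitianField K q} {θ : K} (hφx : φ (x K q) = x K q)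
  (hφy : φ (y K q) = y K q + algebraMap K _ θ) (hθ : θ ≠ 0)
  {Q : Fin N → Fin M → Place K (HermitianField K q)} (hPQ : LabelsOrbits φ Pinf P Q)
  {z : HermitianField K q} {k : ℕ} (hz : Place.poleDivisor z =
    k • (Set.indicator {Pinf} 1 : Place K (HermitianField K q) → ℤ) + Set.indicator {P} 1)
  {n : ℕ} (hn : n ≤ M * p)

include hq hinf hφx hφy hθ hPQ hz

theorem mul_le_of_truncate_eq_zero (h0 : truncate (orbitMultisequence p φ Q z) hn = 0) :
    n * N ≤ k + 1 := by
  classical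
  obtain ⟨hzinf, hzP, hzreg⟩ := valuation_le_of_poleDivisor hPQ.ne_pole hz
  have hinj := orbitPlace_injective hinf hPQ hθ hφy (p := p)
  set S : Finset (Fin N × Fin (M * p)) :=
    Finset.univ ×ˢ Finset.univ.map (Fin.castLEEmb hn) with hS
  have h := card_le_of_value_eq_zero hq hinf hPQ.isRational.constResidues hzinf hzP hzreg
    (S.image fun it => orbitPlace p φ Q it.1 it.2) (by
      simp only [Finset.forall_mem_image]
      exact fun it _ => hPQ.constResidues_orbitPlace _ _) (by
      intro h
      obtain ⟨it, -, hit⟩ := Finset.mem_image.1 h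
      exact orbitPlace_ne_pole hinf hPQ hφx _ _ hit) (by
      intro h
      obtain ⟨it, -, hit⟩ := Finset.mem_image.1 h
      refine hPQ.map_orbitPlace_ne it.1 it.2 0 ?_
      rwa [map_zpow_zero]) (by
      simp only [Finset.forall_mem_image]
      rintro ⟨i, t⟩ hit
      rw [hS, Finset.mem_product, Finset.mem_map] at hit
      obtain ⟨-, j, -, rfl⟩ := hit
      rw [← orbitMultisequence_eq]
      exact congrFun (congrFun h0 i) j)
  rw [Finset.card_image_of_injective _ hinj, hS, Finset.card_product, Finset.card_map,
    Finset.card_univ, Finset.card_univ, Fintype.card_fin, Fintype.card_fin] at h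
  rwa [mul_comm]

/-- A recursion of order `u` for the multisequence holds for few terms. The set `S` collects
indices for which all `u + 1` terms of the relation belong to one orbit. -/
theorem mul_card_le_of_isGeneratedWithOrder {u r : ℕ} (hu : 0 < u) (hup : u < p) (hr : 1 ≤ r)
    (hgen : IsGeneratedWithOrder r (truncate (orbitMultisequence p φ Q z) hn) u) (S : Finset ℕ)
    (hS : ∀ t ∈ S, t + u < n ∧ t % p + u < p) : N * S.card ≤ (k + 1) * r * u + 1 := by
  classical
  obtain ⟨f, hf, hgen⟩ := hgen
  obtain ⟨hzinf, hzP, hzreg⟩ := valuation_le_of_poleDivisor hPQ.ne_pole hz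
  have hinj := orbitPlace_injective hinf hPQ hθ hφy (p := p)
  have hlt : ∀ t ∈ S, t < M * p := fun t ht => by have := (hS t ht).1; omega
  set T : Finset (Fin N × Fin (M * p)) := Finset.univ ×ˢ S.attachFin hlt with hT
  have h := card_le_of_value_eq_eval hq hinf hPQ.isRational.constResidues hPQ.ne_pole hzinf hzP
    hzreg hφx hφy hθ hu hup hr hf
    (T.image fun it => orbitPlace p φ Q it.1 it.2) (by
      simp only [Finset.forall_mem_image]
      exact fun it _ => hPQ.constResidues_orbitPlace _ _) (by
      intro h
      obtain ⟨it, -, hit⟩ := Finset.mem_image.1 h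
      exact orbitPlace_ne_pole hinf hPQ hφx _ _ hit) (by
      simp only [Finset.forall_mem_image]
      exact fun it _ j => hPQ.map_orbitPlace_ne _ _ j) (by
      simp only [Finset.forall_mem_image]
      rintro ⟨i, t, ht⟩ hit
      rw [hT, Finset.mem_product, Finset.mem_attachFin] at hit
      obtain ⟨h1, h2⟩ := hS t hit.2
      have hg := hgen i t h1
      simp only [truncate, orbitMultisequence_eq, Fin.castLE_mk] at hg
      rw [orbitPlace_add φ Q i _ h2] at hg
      rw [hg]
      congr 2
      ext v
      rw [orbitPlace_add φ Q i _ (by have := v.2; omega)])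
  rw [Finset.card_image_of_injective _ hinj, hT, Finset.card_product, Finset.card_attachFin,
    Finset.card_univ, Fintype.card_fin] at h
  calc N * S.card ≤ k * r * u + r * u + 1 := h
    _ = (k + 1) * r * u + 1 := by ring

end HermitianField

theorem theorem3 {p q m N M : ℕ} (hp : p.Prime) (hp_odd : Odd p) (hm : 0 < m) (hq : q = p ^ m)
    [Fact (1 < q)] (hN : 0 < N) (hM : 0 < M) (hNM : N * M = q ^ 3 / p - 1)
    {K : Type*} [Field K] (hK : Nat.card K = q ^ 2)
    -- `P_∞` is the pole of `x`
    (Pinf : Place K (HermitianField K q)) (hPinf : HermitianField.x K q ∉ Pinf.ring)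
    -- the automorphism `φ = φ_{1,0,θ}`
    (θ : K) (hθ : θ ≠ 0) (hθq : θ ^ q + θ = 0)
    (φ : HermitianField K q ≃ₐ[K] HermitianField K q)
    (hφx : φ (HermitianField.x K q) = HermitianField.x K q)
    (hφy : φ (HermitianField.y K q) = HermitianField.y K q + algebraMap K _ θ)
    -- the orbits of `φ`
    (P : Place K (HermitianField K q)) (Q : Fin N → Fin M → Place K (HermitianField K q))
    (hPQ : LabelsOrbits φ Pinf P Q)
    -- the function `z`, with `(z)_∞ = k P_∞ + P` and `k ≤ 2g - 1 = q² - q - 1`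
    (z : HermitianField K q) (k : ℕ) (hk : (k : ℤ) ≤ (q : ℤ) ^ 2 - q - 1)
    (hz : Place.poleDivisor z = k • (Set.indicator {Pinf} 1 : Place K (HermitianField K q) → ℤ)
      + Set.indicator {P} 1)
    (n r : ℕ) (hn : n ≤ M * p) (hr : 1 ≤ r) (hrq : r ≤ q ^ 2 - 1) :
    (q ^ 2 - q < n * N → truncate (orbitMultisequence p φ Q z) hn ≠ 0) ∧
    (truncate (orbitMultisequence p φ Q z) hn ≠ 0 →
      (1 < n → n ≤ p →
        ((n : ℝ) * N - 1) / (N + ((q : ℝ) ^ 2 - q) * r) ≤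
          jointNonlinearComplexity r (truncate (orbitMultisequence p φ Q z) hn)) ∧
      (p ≤ n →
        ((p : ℝ) * N * (n / p : ℕ) - 1) / (N * (n / p : ℕ) + ((q : ℝ) ^ 2 - q) * r) ≤
          jointNonlinearComplexity r (truncate (orbitMultisequence p φ Q z) hn))) := by
  have : Fact p.Prime := ⟨hp⟩
  have hcard : Nat.card K = p ^ (m * 2) := by rw [hK, hq, pow_mul]
  have : Finite K := Nat.finite_of_card_ne_zero (by rw [hcard]; exact (pow_pos hp.pos _).ne')
  have := Fintype.ofFinite K
  have : CharP K p := charP_of_card_eq_prime_pow (by rw [← Nat.card_eq_fintype_card, hcard])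
  have hkR : (k : ℝ) + 1 ≤ (q : ℝ) ^ 2 - q := by
    have : (k : ℤ) + 1 ≤ (q : ℤ) ^ 2 - q := by omega
    exact_mod_cast this
  have hkN : k + 1 ≤ q ^ 2 - q := by
    have : q ≤ q ^ 2 := Nat.le_self_pow two_ne_zero q
    zify [this]
    omega
  have hr0 : (1 : ℝ) ≤ r := by exact_mod_cast hr
  have hpos : 0 < ((q : ℝ) ^ 2 - q) * r :=
    mul_pos (lt_of_lt_of_le (by positivity) hkR) (by linarith)
  refine ⟨fun h h0 => ?_, fun hS => ?_⟩
  · have := HermitianField.mul_le_of_truncate_eq_zero hq hPinf hφx hφy hθ hPQ hz hn h0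
    omega
  set u := jointNonlinearComplexity r (truncate (orbitMultisequence p φ Q z) hn) with hu
  have hcases := jointNonlinearComplexity_cases r hS
  rw [← hu] at hcases
  -- L is the number of blocks and J the number of starting positions in each; k + 1 is replaced by
  -- its upper bound q² - q = 2g.
  have key : ∀ L J : ℕ, N * (L * J) ≤ (k + 1) * r * u + 1 →
      (N : ℝ) * L * J ≤ u * (((q : ℝ) ^ 2 - q) * r) + 1 := by
    intro L J h
    have h1 : (N : ℝ) * (L * J) ≤ (k + 1) * r * u + 1 := by exact_mod_cast h
    have h2 : ((k : ℝ) + 1) * (r * u) ≤ ((q : ℝ) ^ 2 - q) * (r * u) :=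
      mul_le_mul_of_nonneg_right hkR (by positivity)
    linarith
  have hu0 : (0 : ℝ) ≤ u := Nat.cast_nonneg u
  refine ⟨fun _ hnp => ?_, fun hpn => ?_⟩
  · rw [div_le_iff₀ (by positivity)]
    rcases hcases with h | ⟨h1, h2, h3⟩
    · have : (u : ℝ) = n := by exact_mod_cast h
      rw [this] at hu0 ⊢
      nlinarith [mul_nonneg hu0 hpos.le]
    · have := HermitianField.mul_card_le_of_isGeneratedWithOrder hq hPinf hφx hφy hθ hPQ hz hn
        h1 (by omega) hr h3 (Finset.range (n - u)) (by
          intro t ht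
          rw [Finset.mem_range] at ht
          have := Nat.mod_le t p
          omega)
      rw [Finset.card_range] at this
      -- For n ≤ p all terms lie in the first block, where n - u relations start.
      have := key 1 (n - u) (by rwa [one_mul])
      rw [Nat.cast_sub h2.le] at this
      push_cast at this
      linarith
  · set L := n / p with hL
    rw [div_le_iff₀ (by positivity)]
    -- If u ≥ p, then u N ⌊n/p⌋ alone exceeds the numerator of the bound.
    by_cases hup : p ≤ u
    · have h1 : (p : ℝ) * (N * L) ≤ u * (N * L) :=
        mul_le_mul_of_nonneg_right (by exact_mod_cast hup) (by positivity)
      nlinarith [mul_nonneg hu0 hpos.le]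
    · obtain ⟨h1, h2, h3⟩ : 1 ≤ u ∧ u < n ∧ _ := hcases.resolve_left (by omega)
      -- The starting terms are l p + j with l < ⌊n/p⌋ and j < p - u, so that all u + 1 terms of a
      -- relation lie in the complete block l.
      have hinj : Set.InjOn (fun a : ℕ × ℕ => a.1 * p + a.2)
          (Finset.range L ×ˢ Finset.range (p - u) : Finset (ℕ × ℕ)) := by
        rintro ⟨l, j⟩ hlj ⟨l', j'⟩ hlj' h
        simp only [Finset.coe_product, Set.mem_prod, Finset.coe_range, Set.mem_Iio] at hlj hlj' h
        have hj : j = j' := by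
          have := congrArg (· % p) h
          simpa [Nat.add_mod, Nat.mod_eq_of_lt (show j < p by omega),
            Nat.mod_eq_of_lt (show j' < p by omega)] using this
        subst hj
        exact Prod.ext (Nat.eq_of_mul_eq_mul_right hp.pos (Nat.add_right_cancel h)) rfl
      have := HermitianField.mul_card_le_of_isGeneratedWithOrder hq hPinf hφx hφy hθ hPQ hz hn
        h1 (by omega) hr h3
        ((Finset.range L ×ˢ Finset.range (p - u)).image fun a => a.1 * p + a.2) (by
          simp only [Finset.forall_mem_image]
          rintro ⟨l, j⟩ hlj
          simp only [Finset.mem_product, Finset.mem_range] at hlj ⊢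
          have h4 : (l + 1) * p ≤ n :=
            (Nat.mul_le_mul_right p hlj.1).trans (Nat.div_mul_le_self n p)
          have h5 : (l * p + j) % p = j := by
            rw [mul_comm, Nat.mul_add_mod, Nat.mod_eq_of_lt (by omega)]
          rw [h5]
          rw [add_mul, one_mul] at h4
          omega)
      rw [Finset.card_image_of_injOn hinj, Finset.card_product, Finset.card_range,
        Finset.card_range] at this
      have := key L (p - u) this
      rw [Nat.cast_sub (by omega)] at this
      linarith
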